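/- Let $V$ be a vertex operator algebra over $\mathbb{C}$, let $\mathcal{W}$ be the category of weak $V$-modules, and let $\mathcal{C}\subseteq\mathcal{W}$ be a full subcategory of grading-restricted generalized $V$-modules such that: $0$ and $V$ are objects of $\mathcal{C}$; $\mathcal{C}$ is closed under submodules, quotients and finite direct sums; every object of $\mathcal{C}$ is a finitely generated $V$-module. Assume that $\mathcal{C}$ carries a $\mathbb{C}$-linear braided tensor category structure $(\boxtimes,V,l,r,\mathcal{A},\mathcal{R})$ with unit object $V$ (the tensor product of morphisms being bilinear, $\mathcal{A}_{W_1,W_2,W_3}:W_1\boxtimes(W_2\boxtimes W_3)\to(W_1\boxtimes W_2)\boxtimes W_3$), with a twist, i.e. a natural isomorphism $\theta:\mathrm{Id}_{\mathcal{C}}\to\mathrm{Id}_{\mathcal{C}}$ with $\theta_V=\mathrm{Id}_V$ and $\theta_{W_1\boxtimes W_2}=\mathcal{R}_{W_2,W_1}\circ\mathcal{R}_{W_1,W_2}\circ(\theta_{W_1}\boxtimes\theta_{W_2})$, and that the functors $W\boxtimes\bullet$ and $\bullet\boxtimes W$ are right exact for every $W$ in $\mathcal{C}$. Let $\mathrm{Ind}(\mathcal{C})$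 be the full subcategory of $\mathcal{W}$ whose objects are the weak modules isomorphic to direct limits in $\mathcal{W}$ of direct systems $I\to\mathcal{C}$ indexed by directed sets $I$. For a weak module $X$ let $I_X$ be the directed set of $V$-submodules of $X$ that are objects of $\mathcal{C}$; for $W\in I_X$ let $i_W:W\to X$ be the inclusion, and for a homomorphism $F:X\to Y$ let $F|_W:W\to F(W)$ be its restriction, where $F(W)\in I_Y$. Then $\mathrm{Ind}(\mathcal{C})$ is a $\mathbb{C}$-linear abelian category, and it has a $\mathbb{C}$-linear braided tensor category structure with twist $(\widehat{\boxtimes},V,\mathfrak{l},\mathfrak{r},\mathfrak{A},\widehat{\mathcal{R}},\Theta)$ given as follows, for objects $X,X_1,X_2,X_3$ of $\mathrm{Ind}(\mathcal{C})$. (1) $X_1\widehat{\boxtimes}X_2$, with homomorphisms $\phi_{W_1,W_2}:W_1\boxtimes W_2\to X_1\widehat{\boxtimes}X_2$, is the direct limit in $\mathcal{W}$ of the system $(W_1,W_2)\mapsto W_1\boxtimes W_2$ over $I_{X_1}\times I_{X_2}$, whose transition maps are the tensor products of the inclusions. For morphisms $F_k:X_k\to Y_k$ in $\mathrm{Ind}(\mathcal{C})$,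 $(F_1\widehat{\boxtimes}F_2)\circ\phi_{W_1,W_2}=\phi_{F_1(W_1),F_2(W_2)}\circ(F_1|_{W_1}\boxtimes F_2|_{W_2})$. (2) The unit object is $V$, and for $U\in I_V$, $W\in I_X$: $\mathfrak{l}_X\circ\phi_{U,W}=i_W\circ l_W\circ(i_U\boxtimes\mathrm{Id}_W)$ and $\mathfrak{r}_X\circ\phi_{W,U}=i_W\circ r_W\circ(\mathrm{Id}_W\boxtimes i_U)$. (3) Write $\phi'_{W_1,W_2}:W_1\boxtimes W_2\to\mathrm{im}\,\phi_{W_1,W_2}$ for the surjection induced by $\phi_{W_1,W_2}$. The maps $\phi_{W_1,\mathrm{im}\,\phi_{W_2,W_3}}\circ(\mathrm{Id}_{W_1}\boxtimes\phi'_{W_2,W_3})$ exhibit $X_1\widehat{\boxtimes}(X_2\widehat{\boxtimes}X_3)$ as the direct limit of the system $(W_1,W_2,W_3)\mapsto W_1\boxtimes(W_2\boxtimes W_3)$ over $I_{X_1}\times I_{X_2}\times I_{X_3}$, and the maps $\phi_{\mathrm{im}\,\phi_{W_1,W_2},W_3}\circ(\phi'_{W_1,W_2}\boxtimes\mathrm{Id}_{W_3})$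 exhibit $(X_1\widehat{\boxtimes}X_2)\widehat{\boxtimes}X_3$ as the direct limit of $(W_1,W_2,W_3)\mapsto(W_1\boxtimes W_2)\boxtimes W_3$ ("Fubini" isomorphisms). Under these identifications, $\mathfrak{A}_{X_1,X_2,X_3}:X_1\widehat{\boxtimes}(X_2\widehat{\boxtimes}X_3)\to(X_1\widehat{\boxtimes}X_2)\widehat{\boxtimes}X_3$ is the map of direct limits induced by the isomorphisms $\mathcal{A}_{W_1,W_2,W_3}$. (4) $\widehat{\mathcal{R}}_{X_1,X_2}\circ\phi_{W_1,W_2}=\phi_{W_2,W_1}\circ\mathcal{R}_{W_1,W_2}$ for $W_1\in I_{X_1}$, $W_2\in I_{X_2}$, and $\Theta_X\circ i_W=i_W\circ\theta_W$ for $W\in I_X$; moreover $\Theta_V=\mathrm{Id}_V$ and $\Theta_{X_1\widehat{\boxtimes}X_2}=\widehat{\mathcal{R}}_{X_2,X_1}\circ\widehat{\mathcal{R}}_{X_1,X_2}\circ(\Theta_{X_1}\widehat{\boxtimes}\Theta_{X_2})$. -/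

import Mathlib

open CategoryTheory MonoidalCategory Limits

universe u

noncomputable section

/-! ### Vertex operator algebras and weak modules -/

/-- The Jacobi identity, written in components. With `Y(v, x) = ∑ vₙ x ^ (-n - 1)`, this is the
equality of the coefficients of `x₀ ^ (-l - 1) x₁ ^ (-m - 1) x₂ ^ (-n - 1)` on the two sides of
`x₀⁻¹ δ((x₁ - x₂) / x₀) Y_W(v₁, x₁) Y_W(v₂, x₂) - x₀⁻¹ δ((x₂ - x₁) / (-x₀)) Y_W(v₂, x₂) Y_W(v₁, x₁)
  = x₂⁻¹ δ((x₁ - x₀) / x₂) Y_W(Y(v₁, x₀) v₂, x₂)`.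
The sums are finite as soon as the modes satisfy lower truncation. -/
def JacobiIdentity {A W : Type u} [AddCommGroup A] [Module ℂ A] [AddCommGroup W] [Module ℂ W]
    (Y : ℤ → A →ₗ[ℂ] A →ₗ[ℂ] A) (YW : ℤ → A →ₗ[ℂ] W →ₗ[ℂ] W) : Prop :=
  ∀ (v₁ v₂ : A) (w : W) (l m n : ℤ),
    (∑ᶠ i : ℕ, ((-1 : ℤ) ^ i * Ring.choose l i) •
        (YW (m + l - i) v₁ (YW (n + i) v₂ w)
          - (Int.negOnePow l : ℤ) • YW (n + l - i) v₂ (YW (m + i) v₁ w)))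
      = ∑ᶠ i : ℕ, (Ring.choose m i) • YW (m + n - i) (Y (l + i) v₁ v₂) w

/-- Vertex operator algebras (over `ℂ`). The vertex operator `Y(v, x) = ∑ vₙ x ^ (-n - 1)` is given
by its modes `mode n v = vₙ`, and `L(n) = ωₙ₊₁`. The conformal weight spaces `V₍ₙ₎` are the
`L(0)`-eigenspaces of eigenvalue `n`. -/
structure VertexOperatorAlgebra : Type (u + 1) where
  carrier : Type u
  [addCommGroup : AddCommGroup carrier]
  [module : Module ℂ carrier]
  /-- `mode n v = vₙ` -/
  mode : ℤ → carrier →ₗ[ℂ] carrier →ₗ[ℂ] carrier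
  /-- the vacuum vector `𝟏` -/
  vacuum : carrier
  /-- the conformal vector `ω` -/
  conformal : carrier
  centralCharge : ℂ
  lower_truncation : ∀ u v : carrier, ∃ N : ℤ, ∀ n ≥ N, mode n u v = 0
  vacuum_property : ∀ (n : ℤ) (v : carrier), mode n vacuum v = if n = -1 then v else 0
  creation : ∀ v : carrier, mode (-1) v vacuum = v ∧ ∀ n : ℤ, 0 ≤ n → mode n v vacuum = 0
  jacobi : JacobiIdentity mode mode
  /-- `[L(m), L(n)] = (m - n) L(m + n) + (m³ - m) / 12 δ_{m + n, 0} c` -/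
  virasoro : ∀ (m n : ℤ) (v : carrier),
    mode (m + 1) conformal (mode (n + 1) conformal v)
        - mode (n + 1) conformal (mode (m + 1) conformal v)
      = ((m : ℂ) - n) • mode (m + n + 1) conformal v
        + (if m + n = 0 then ((m : ℂ) ^ 3 - m) / 12 * centralCharge else 0) • v
  /-- `Y(L(-1) v, x) = d/dx Y(v, x)` -/
  derivative : ∀ (n : ℤ) (v w : carrier),
    mode n (mode 0 conformal v) w = (-(n : ℂ)) • mode (n - 1) v w
  /-- `V = ⨁ V₍ₙ₎` over `n : ℤ` -/
  grading : DirectSum.IsInternal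
    (fun n : ℤ => Module.End.eigenspace (mode 1 conformal) (n : ℂ))
  finite_dim : ∀ n : ℤ, FiniteDimensional ℂ
    (Module.End.eigenspace (mode 1 conformal) (n : ℂ))
  bounded_below : ∃ N : ℤ, ∀ n ≤ N, Module.End.eigenspace (mode 1 conformal) (n : ℂ) = ⊥

attribute [instance] VertexOperatorAlgebra.addCommGroup VertexOperatorAlgebra.module

/-- Weak modules for a vertex operator algebra, with `Y_W(v, x) = ∑ vₙ x ^ (-n - 1)` given by its
modes `mode n v = vₙ`. -/
structure WeakModule (V : VertexOperatorAlgebra.{u}) : Type (u + 1) where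
  carrier : Type u
  [addCommGroup : AddCommGroup carrier]
  [module : Module ℂ carrier]
  /-- `mode n v = vₙ` -/
  mode : ℤ → V.carrier →ₗ[ℂ] carrier →ₗ[ℂ] carrier
  lower_truncation : ∀ (v : V.carrier) (w : carrier), ∃ N : ℤ, ∀ n ≥ N, mode n v w = 0
  vacuum_property : ∀ (n : ℤ) (w : carrier), mode n V.vacuum w = if n = -1 then w else 0
  jacobi : JacobiIdentity V.mode mode
  /-- `Y_W(L(-1) v, x) = d/dx Y_W(v, x)` -/
  derivative : ∀ (n : ℤ) (v : V.carrier) (w : carrier),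
    mode n (V.mode 0 V.conformal v) w = (-(n : ℂ)) • mode (n - 1) v w

attribute [instance] WeakModule.addCommGroup WeakModule.module

/-- A vertex operator algebra as a weak module for itself. -/
def VertexOperatorAlgebra.adjoint (V : VertexOperatorAlgebra.{u}) : WeakModule V where
  carrier := V.carrier
  mode := V.mode
  lower_truncation := V.lower_truncation
  vacuum_property := V.vacuum_property
  jacobi := V.jacobi
  derivative := V.derivative

namespace WeakModule

variable {V : VertexOperatorAlgebra.{u}}

/-- `V`-homomorphisms, as a space of linear maps. -/
def homs (X Y : WeakModule V) : Submodule ℂ (X.carrier →ₗ[ℂ] Y.carrier) where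
  carrier := {f | ∀ (n : ℤ) (v : V.carrier) (x : X.carrier), f (X.mode n v x) = Y.mode n v (f x)}
  zero_mem' := by intro n v x; simp
  add_mem' := by
    intro f g hf hg n v x
    simp [hf n v x, hg n v x]
  smul_mem' := by
    intro c f hf n v x
    simp [hf n v x]

/-- The category `𝒲` of weak `V`-modules. -/
instance : Category.{u} (WeakModule V) where
  Hom X Y := homs X Y
  id X := ⟨LinearMap.id, fun _ _ _ => rfl⟩
  comp f g := ⟨g.1 ∘ₗ f.1, fun n v x => by
    rw [LinearMap.comp_apply, f.2 n v x, g.2 n v (f.1 x), LinearMap.comp_apply]⟩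

/-- The linear map underlying a `V`-homomorphism. -/
def toLin {X Y : WeakModule V} (f : X ⟶ Y) : X.carrier →ₗ[ℂ] Y.carrier := Subtype.val f

instance : Preadditive (WeakModule V) where
  homGroup X Y := inferInstanceAs (AddCommGroup (homs X Y))
  add_comp _ _ _ f f' g := Subtype.ext (LinearMap.comp_add f.1 f'.1 g.1)
  comp_add _ _ _ f g g' := Subtype.ext (LinearMap.add_comp f.1 g'.1 g.1)

instance : Linear ℂ (WeakModule V) where
  homModule X Y := inferInstanceAs (Module ℂ (homs X Y))
  smul_comp _ _ _ r f g := Subtype.ext (LinearMap.comp_smul g.1 r f.1)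
  comp_smul _ _ _ f r g := Subtype.ext (LinearMap.smul_comp r g.1 f.1)

/-- The generalized `L(0)`-eigenspace `W_[h]`. -/
def genWeightSpace (W : WeakModule V) (h : ℂ) : Submodule ℂ W.carrier :=
  Module.End.maxGenEigenspace (W.mode 1 V.conformal) h

open scoped Classical in
/-- Grading-restricted generalized `V`-modules. -/
structure IsGradingRestricted (W : WeakModule V) : Prop where
  grading : DirectSum.IsInternal W.genWeightSpace
  finite_dim : ∀ h : ℂ, FiniteDimensional ℂ (W.genWeightSpace h)
  truncated : ∀ h : ℂ, ∃ N : ℤ, ∀ n ≤ N, W.genWeightSpace (h + n) = ⊥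

/-- `V`-submodules of a weak module. -/
structure Sub (X : WeakModule V) extends Submodule ℂ X.carrier where
  mode_mem : ∀ (n : ℤ) (v : V.carrier) (x : X.carrier), x ∈ carrier → X.mode n v x ∈ carrier

namespace Sub

variable {X : WeakModule V}

theorem toSubmodule_injective :
    Function.Injective (Sub.toSubmodule : X.Sub → Submodule ℂ X.carrier) := by
  rintro ⟨S, hS⟩ ⟨T, hT⟩ h
  cases h
  rfl

/-- `V`-submodules are ordered by inclusion. -/
instance : PartialOrder X.Sub := PartialOrder.lift Sub.toSubmodule toSubmodule_injective

/-- A `V`-submodule as a weak module. -/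
def toModule (S : X.Sub) : WeakModule V where
  carrier := S.toSubmodule
  mode n :=
    { toFun := fun v => (X.mode n v).restrict (fun x hx => S.mode_mem n v x hx)
      map_add' := fun u v => by ext x; simp
      map_smul' := fun c v => by ext x; simp }
  lower_truncation v w := by
    obtain ⟨N, hN⟩ := X.lower_truncation v w
    exact ⟨N, fun n hn => Subtype.ext (hN n hn)⟩
  vacuum_property n w := by
    apply Subtype.ext
    have h := X.vacuum_property n w
    split_ifs with hn
    · simpa [hn] using h
    · simpa [hn] using h
  jacobi := by
    intro v₁ v₂ w l m n
    apply Subtype.ext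
    have hinj : Function.Injective (S.toSubmodule.subtype.toAddMonoidHom) :=
      Subtype.val_injective
    refine ((AddMonoidHom.map_finsum_of_injective _ hinj _).trans ?_).trans
      (AddMonoidHom.map_finsum_of_injective _ hinj _).symm
    exact X.jacobi v₁ v₂ w l m n
  derivative n v w := Subtype.ext (X.derivative n v w)

/-- The inclusion `i_S : S ⟶ X`. -/
def incl (S : X.Sub) : S.toModule ⟶ X := ⟨S.toSubmodule.subtype, fun _ _ _ => rfl⟩

/-- The inclusion `f_S^T : S ⟶ T` of `V`-submodules `S ≤ T` of `X`. -/
def inclOfLE {S T : X.Sub} (h : S ≤ T) : S.toModule ⟶ T.toModule :=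
  ⟨Submodule.inclusion h, fun _ _ _ => rfl⟩

/-- The image of a `V`-homomorphism. -/
def image {W : WeakModule V} (f : W ⟶ X) : X.Sub where
  toSubmodule := LinearMap.range (toLin f)
  mode_mem := by
    rintro n v _ ⟨w, rfl⟩
    exact ⟨W.mode n v w, f.2 n v w⟩

/-- The surjection of `W` onto the image of `f : W ⟶ X`. -/
def toImage {W : WeakModule V} (f : W ⟶ X) : W ⟶ (image f).toModule :=
  ⟨(toLin f).rangeRestrict, fun n v w => Subtype.ext (f.2 n v w)⟩

theorem toImage_surjective {W : WeakModule V} (f : W ⟶ X) :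
    Function.Surjective (toLin (toImage f)) :=
  LinearMap.surjective_rangeRestrict _

end Sub

/-- Finitely generated weak modules: some finite subset lies in no proper `V`-submodule. -/
def IsFinitelyGenerated (W : WeakModule V) : Prop :=
  ∃ S : Finset W.carrier, ∀ N : W.Sub, (∀ s ∈ S, s ∈ N.toSubmodule) → N.toSubmodule = ⊤

end WeakModule

open WeakModule

variable {V : VertexOperatorAlgebra.{u}}

/-- The assumptions on a full category `C` of `V`-modules: its objects are finitely generated
grading-restricted generalized `V`-modules, it contains the zero module, and it is closed under
submodules, quotients and finite direct sums. -/
structure IsAdmissible (C : ObjectProperty (WeakModule V)) : Prop where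
  gradingRestricted : ∀ W : WeakModule V, C W → W.IsGradingRestricted
  zero : ∃ Z : WeakModule V, IsZero Z ∧ C Z
  submodules : ∀ {X Y : WeakModule V} (f : X ⟶ Y), Function.Injective (toLin f) → C Y → C X
  quotients : ∀ {X Y : WeakModule V} (f : X ⟶ Y), Function.Surjective (toLin f) → C X → C Y
  directSums : ∀ {X Y : WeakModule V} (b : BinaryBicone X Y), Nonempty b.IsBilimit →
    C X → C Y → C b.pt
  finitelyGenerated : ∀ W : WeakModule V, C W → W.IsFinitelyGenerated

/-! ### Direct limits and the direct limit completion -/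

/-- `(X, φ)` is a direct limit (colimit) of the system `F`. -/
def IsDirectLimit {J : Type u} [Category.{u} J] {D : Type (u + 1)} [Category.{u} D]
    (F : J ⥤ D) (X : D) (φ : ∀ j, F.obj j ⟶ X) : Prop :=
  ∃ c : F ⟶ (Functor.const J).obj X,
    (∀ j, c.app j = φ j) ∧ Nonempty (IsColimit (Cocone.mk X c))

/-- The direct limit completion `Ind(C)` of `C` in the category of weak `V`-modules: the weak
modules that are direct limits of systems in `C` indexed by a directed set. -/
def IndCompletion (C : ObjectProperty (WeakModule V)) : ObjectProperty (WeakModule V) := fun X =>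
  ∃ (J : Type u) (_ : Preorder J) (_ : Nonempty J) (_ : IsDirectedOrder J)
    (F : J ⥤ C.FullSubcategory) (φ : ∀ j, (F.obj j).obj ⟶ X), IsDirectLimit (F ⋙ C.ι) X φ

/-- The set `I_X` of `V`-submodules of `X` which are objects of `C`, ordered by inclusion. -/
abbrev CSub (C : ObjectProperty (WeakModule V)) (X : WeakModule V) : Type u :=
  {S : X.Sub // C S.toModule}

namespace CSub

variable {C : ObjectProperty (WeakModule V)} {X Y : WeakModule V}

/-- A `C`-submodule as an object of `C`. -/
abbrev obj (W : CSub C X) : C.FullSubcategory := ⟨W.1.toModule, W.2⟩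

/-- The inclusion `i_W : W ⟶ X`. -/
def incl (W : CSub C X) : W.obj.obj ⟶ X := W.1.incl

/-- The inclusion `f_W^{W'} : W ⟶ W'` in `C`, for `C`-submodules `W ≤ W'` of `X`. -/
def transition {W W' : CSub C X} (h : W ≤ W') : W.obj ⟶ W'.obj :=
  ObjectProperty.homMk (Sub.inclOfLE h)

theorem transition_refl (W : CSub C X) (h : W ≤ W) : transition h = 𝟙 W.obj := rfl

theorem transition_trans {W₁ W₂ W₃ : CSub C X} (h : W₁ ≤ W₂) (h' : W₂ ≤ W₃) (h'' : W₁ ≤ W₃) :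
    transition h'' = transition h ≫ transition h' := rfl

/-- The image `im f` of a homomorphism from an object of `C`, as a `C`-submodule. -/
def image (hC : IsAdmissible C) {W : C.FullSubcategory} (f : W.obj ⟶ X) : CSub C X :=
  ⟨Sub.image f, hC.quotients (Sub.toImage f) (Sub.toImage_surjective f) W.property⟩

/-- The surjection `f' : W ⟶ im f` in `C` induced by `f`. -/
def toImage (hC : IsAdmissible C) {W : C.FullSubcategory} (f : W.obj ⟶ X) :
    W ⟶ (image hC f).obj :=
  ObjectProperty.homMk (Sub.toImage f)

/-- The `C`-submodule `F(W)` of `Y`, for `F : X ⟶ Y` and a `C`-submodule `W` of `X`. -/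
def map (hC : IsAdmissible C) (F : X ⟶ Y) (W : CSub C X) : CSub C Y :=
  image hC (W := W.obj) (W.incl ≫ F)

/-- The restriction `F|_W : W ⟶ F(W)`. -/
def restrict (hC : IsAdmissible C) (F : X ⟶ Y) (W : CSub C X) : W.obj ⟶ (map hC F W).obj :=
  toImage hC (W := W.obj) (W.incl ≫ F)

end CSub

/-! ### Tensor products -/

/-- A twist on a braided monoidal category. -/
structure IsTwist {D : Type (u + 1)} [Category.{u} D] [MonoidalCategory D] [BraidedCategory D]
    (θ : 𝟭 D ≅ 𝟭 D) : Prop where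
  unit : θ.hom.app (𝟙_ D) = 𝟙 (𝟙_ D)
  balancing : ∀ X Y : D,
    θ.hom.app (X ⊗ Y) = (θ.hom.app X ⊗ₘ θ.hom.app Y) ≫ (β_ X Y).hom ≫ (β_ Y X).hom

section Systems

variable (C : ObjectProperty (WeakModule V)) [MonoidalCategory C.FullSubcategory]

/-- The system `α_{X₁} ⊠ α_{X₂}`, `(W₁, W₂) ↦ W₁ ⊠ W₂`, with transition maps given by inclusions. -/
def tensorSystem (X₁ X₂ : WeakModule V) : CSub C X₁ × CSub C X₂ ⥤ WeakModule V where
  obj W := (W.1.obj ⊗ W.2.obj).obj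
  map f := (CSub.transition (leOfHom f.1) ⊗ₘ CSub.transition (leOfHom f.2)).hom
  map_id W := by
    simp [CSub.transition_refl]
  map_comp f g := by
    simp only [← ObjectProperty.FullSubcategory.comp_hom, tensorHom_comp_tensorHom]
    rfl

/-- The system `α_{X₁} ⊠ (α_{X₂} ⊠ α_{X₃})`, `(W₁, W₂, W₃) ↦ W₁ ⊠ (W₂ ⊠ W₃)`. -/
def tensorSystemRight (X₁ X₂ X₃ : WeakModule V) : CSub C X₁ × CSub C X₂ × CSub C X₃ ⥤ WeakModule V where
  obj W := (W.1.obj ⊗ (W.2.1.obj ⊗ W.2.2.obj)).obj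
  map f := (CSub.transition (leOfHom f.1) ⊗ₘ
    (CSub.transition (leOfHom f.2.1) ⊗ₘ CSub.transition (leOfHom f.2.2))).hom
  map_id W := by
    simp [CSub.transition_refl]
  map_comp f g := by
    simp only [← ObjectProperty.FullSubcategory.comp_hom, tensorHom_comp_tensorHom]
    rfl

/-- The system `(α_{X₁} ⊠ α_{X₂}) ⊠ α_{X₃}`, `(W₁, W₂, W₃) ↦ (W₁ ⊠ W₂) ⊠ W₃`. -/
def tensorSystemLeft (X₁ X₂ X₃ : WeakModule V) : CSub C X₁ × CSub C X₂ × CSub C X₃ ⥤ WeakModule V where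
  obj W := ((W.1.obj ⊗ W.2.1.obj) ⊗ W.2.2.obj).obj
  map f := ((CSub.transition (leOfHom f.1) ⊗ₘ CSub.transition (leOfHom f.2.1)) ⊗ₘ
    CSub.transition (leOfHom f.2.2)).hom
  map_id W := by
    simp [CSub.transition_refl]
  map_comp f g := by
    simp only [← ObjectProperty.FullSubcategory.comp_hom, tensorHom_comp_tensorHom]
    rfl

end Systems

section Structure

variable {C : ObjectProperty (WeakModule V)} [MonoidalCategory C.FullSubcategory]
  [MonoidalCategory (IndCompletion C).FullSubcategory]

/-- A family of homomorphisms `φ_{W₁, W₂} : W₁ ⊠ W₂ ⟶ X₁ ⊠̂ X₂`, for `X₁`, `X₂` in `Ind(C)` and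
`C`-submodules `W₁ ⊆ X₁`, `W₂ ⊆ X₂`. -/
abbrev TensorLegs (C : ObjectProperty (WeakModule V)) [MonoidalCategory C.FullSubcategory]
    [MonoidalCategory (IndCompletion C).FullSubcategory] : Type (u + 1) :=
  ∀ (X₁ X₂ : (IndCompletion C).FullSubcategory) (W₁ : CSub C X₁.obj) (W₂ : CSub C X₂.obj),
    (W₁.obj ⊗ W₂.obj).obj ⟶ (X₁ ⊗ X₂).obj

/-- The composition
`W₁ ⊠ (W₂ ⊠ W₃) ⟶ W₁ ⊠ im φ_{W₂, W₃} ⟶ X₁ ⊠̂ (X₂ ⊠̂ X₃)` of `Id ⊠ φ'_{W₂, W₃}` with `φ`. -/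
def iteratedRight (hC : IsAdmissible C) (φ : TensorLegs C)
    (X₁ X₂ X₃ : (IndCompletion C).FullSubcategory)
    (W₁ : CSub C X₁.obj) (W₂ : CSub C X₂.obj) (W₃ : CSub C X₃.obj) :
    (W₁.obj ⊗ (W₂.obj ⊗ W₃.obj)).obj ⟶ (X₁ ⊗ (X₂ ⊗ X₃)).obj :=
  (W₁.obj ◁ CSub.toImage hC (φ X₂ X₃ W₂ W₃)).hom ≫
    φ X₁ (X₂ ⊗ X₃) W₁ (CSub.image hC (φ X₂ X₃ W₂ W₃))

/-- The composition
`(W₁ ⊠ W₂) ⊠ W₃ ⟶ im φ_{W₁, W₂} ⊠ W₃ ⟶ (X₁ ⊠̂ X₂) ⊠̂ X₃` of `φ'_{W₁, W₂} ⊠ Id` with `φ`. -/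
def iteratedLeft (hC : IsAdmissible C) (φ : TensorLegs C)
    (X₁ X₂ X₃ : (IndCompletion C).FullSubcategory)
    (W₁ : CSub C X₁.obj) (W₂ : CSub C X₂.obj) (W₃ : CSub C X₃.obj) :
    ((W₁.obj ⊗ W₂.obj) ⊗ W₃.obj).obj ⟶ ((X₁ ⊗ X₂) ⊗ X₃).obj :=
  (CSub.toImage hC (φ X₁ X₂ W₁ W₂) ▷ W₃.obj).hom ≫
    φ (X₁ ⊗ X₂) X₃ (CSub.image hC (φ X₁ X₂ W₁ W₂)) W₃

/-- The braided monoidal structure on `Ind(C)` with the natural automorphism `Θ` of the identity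
and the homomorphisms `φ_{W₁, W₂} : W₁ ⊠ W₂ ⟶ X₁ ⊠̂ X₂` is
`(⊠̂, V, 𝔩, 𝔯, 𝔄, R̂, Θ)`, the structure induced by the braided monoidal structure on `C` with unit
object `V` (identified with the monoidal unit by `e`) and twist `θ`.
The associativity isomorphisms `X₁ ⊠ (X₂ ⊠ X₃) ⟶ (X₁ ⊠ X₂) ⊠ X₃` are the inverses of the
associators `α_ X₁ X₂ X₃`. -/
structure IsInducedStructure (hC : IsAdmissible C) (hV : C V.adjoint)
    [BraidedCategory C.FullSubcategory]
    (e : 𝟙_ C.FullSubcategory ≅ ⟨V.adjoint, hV⟩)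
    (θ : 𝟭 C.FullSubcategory ≅ 𝟭 C.FullSubcategory)
    [BraidedCategory (IndCompletion C).FullSubcategory]
    (Θ : 𝟭 (IndCompletion C).FullSubcategory ≅ 𝟭 (IndCompletion C).FullSubcategory)
    (φ : TensorLegs C) : Prop where
  /-- `X₁ ⊠̂ X₂` is the direct limit of the `W₁ ⊠ W₂` in the category of weak modules. -/
  tensor_obj : ∀ X₁ X₂ : (IndCompletion C).FullSubcategory,
    IsDirectLimit (tensorSystem C X₁.obj X₂.obj) (X₁ ⊗ X₂).obj (fun W => φ X₁ X₂ W.1 W.2)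
  /-- `(F₁ ⊠̂ F₂) ∘ φ_{W₁, W₂} = φ_{F₁(W₁), F₂(W₂)} ∘ (F₁|_{W₁} ⊠ F₂|_{W₂})` -/
  tensor_hom : ∀ {X₁ X₂ Y₁ Y₂ : (IndCompletion C).FullSubcategory} (F₁ : X₁ ⟶ Y₁) (F₂ : X₂ ⟶ Y₂)
    (W₁ : CSub C X₁.obj) (W₂ : CSub C X₂.obj),
    φ X₁ X₂ W₁ W₂ ≫ (F₁ ⊗ₘ F₂).hom =
      (CSub.restrict hC F₁.hom W₁ ⊗ₘ CSub.restrict hC F₂.hom W₂).hom ≫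
        φ Y₁ Y₂ (CSub.map hC F₁.hom W₁) (CSub.map hC F₂.hom W₂)
  /-- The unit object is `V`. -/
  unit_obj : (𝟙_ (IndCompletion C).FullSubcategory).obj = V.adjoint
  /-- `𝔩_X ∘ φ_{U, W} = i_W ∘ l_W ∘ (i_U ⊠ Id_W)` -/
  left_unit : ∀ (X : (IndCompletion C).FullSubcategory)
    (U : CSub C (𝟙_ (IndCompletion C).FullSubcategory).obj) (W : CSub C X.obj),
    φ (𝟙_ _) X U W ≫ (λ_ X).hom.hom =
      ((ObjectProperty.homMk (U.incl ≫ eqToHom unit_obj) ≫ e.inv) ▷ W.obj ≫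
        (λ_ W.obj).hom).hom ≫ W.incl
  /-- `𝔯_X ∘ φ_{W, U} = i_W ∘ r_W ∘ (Id_W ⊠ i_U)` -/
  right_unit : ∀ (X : (IndCompletion C).FullSubcategory) (W : CSub C X.obj)
    (U : CSub C (𝟙_ (IndCompletion C).FullSubcategory).obj),
    φ X (𝟙_ _) W U ≫ (ρ_ X).hom.hom =
      (W.obj ◁ (ObjectProperty.homMk (U.incl ≫ eqToHom unit_obj) ≫ e.inv) ≫
        (ρ_ W.obj).hom).hom ≫ W.incl
  /-- The "Fubini" isomorphism `T_{X₁, (X₂, X₃)}`: the maps `φ_{W₁, im φ} ∘ (Id ⊠ φ'_{W₂, W₃})`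
  identify the direct limit of the `W₁ ⊠ (W₂ ⊠ W₃)` with `X₁ ⊠̂ (X₂ ⊠̂ X₃)`. -/
  fubini_right : ∀ X₁ X₂ X₃ : (IndCompletion C).FullSubcategory,
    IsDirectLimit (tensorSystemRight C X₁.obj X₂.obj X₃.obj) (X₁ ⊗ (X₂ ⊗ X₃)).obj
      (fun W => iteratedRight hC φ X₁ X₂ X₃ W.1 W.2.1 W.2.2)
  /-- The "Fubini" isomorphism `T_{(X₁, X₂), X₃}`: the maps `φ_{im φ, W₃} ∘ (φ'_{W₁, W₂} ⊠ Id)`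
  identify the direct limit of the `(W₁ ⊠ W₂) ⊠ W₃` with `(X₁ ⊠̂ X₂) ⊠̂ X₃`. -/
  fubini_left : ∀ X₁ X₂ X₃ : (IndCompletion C).FullSubcategory,
    IsDirectLimit (tensorSystemLeft C X₁.obj X₂.obj X₃.obj) ((X₁ ⊗ X₂) ⊗ X₃).obj
      (fun W => iteratedLeft hC φ X₁ X₂ X₃ W.1 W.2.1 W.2.2)
  /-- `𝔄 = T_{(X₁, X₂), X₃} ∘ Â ∘ T_{X₁, (X₂, X₃)}⁻¹`: under the Fubini isomorphisms, `𝔄` is the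
  map of direct limits given by the associativity isomorphisms of `C`. -/
  associativity : ∀ (X₁ X₂ X₃ : (IndCompletion C).FullSubcategory)
    (W₁ : CSub C X₁.obj) (W₂ : CSub C X₂.obj) (W₃ : CSub C X₃.obj),
    iteratedRight hC φ X₁ X₂ X₃ W₁ W₂ W₃ ≫ (α_ X₁ X₂ X₃).inv.hom =
      (α_ W₁.obj W₂.obj W₃.obj).inv.hom ≫ iteratedLeft hC φ X₁ X₂ X₃ W₁ W₂ W₃
  /-- `R̂_{X₁, X₂} ∘ φ_{W₁, W₂} = φ_{W₂, W₁} ∘ R_{W₁, W₂}` -/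
  braiding : ∀ (X₁ X₂ : (IndCompletion C).FullSubcategory)
    (W₁ : CSub C X₁.obj) (W₂ : CSub C X₂.obj),
    φ X₁ X₂ W₁ W₂ ≫ (β_ X₁ X₂).hom.hom = (β_ W₁.obj W₂.obj).hom.hom ≫ φ X₂ X₁ W₂ W₁
  /-- `Θ_X ∘ i_W = i_W ∘ θ_W` -/
  twist : ∀ (X : (IndCompletion C).FullSubcategory) (W : CSub C X.obj),
    W.incl ≫ (Θ.hom.app X).hom = (θ.hom.app W.obj).hom ≫ W.incl

end Structure

end

/-! Since `C` is closed under quotients, a weak module lies in `Ind(C)` exactly when it is the union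
of its `C`-submodules (`indCompletion_iff`): every element of a directed colimit comes from some
stage, and the image of that stage is a `C`-submodule. This criterion passes to submodules,
quotients and finite products, so `Ind(C)` inherits an abelian structure from the category of weak
modules, which is abelian with kernels, cokernels and direct limits computed on underlying vector
spaces.

The tensor structure rests on two facts. Density: an object `X` of `Ind(C)` is the colimit of the
objects of `C` mapping to it, the `C`-submodules being enough. Compactness: submodules of objects of
`C` are again in `C`, hence finitely generated, so objects of `C` behave like finitely presented
modules. A homomorphism from such an object to a directed colimit of objects of `C` factors through
a stage (`IsAdmissible.exists_factor`), and two homomorphisms to a stage that agree in the colimit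
agree at a later stage (`IsAdmissible.exists_comp_map_eq`).

The tensor product of `X` and `Y` is the colimit of `A ⊠ B` over all `A ⟶ X` and `B ⟶ Y` from `C`;
its canonical maps are called legs. By compactness, a homomorphism from `D` in `C` to this colimit
is a class of homomorphisms `D ⟶ A ⊠ B` modulo refinement of `A` and `B`. Hence a natural family on
triples `(A, B, E)` extends uniquely to an iterated tensor product
(`TensorExtension.exists_desc_left`, `TensorExtension.hom_ext_left` and their mirror images), which
is the Fubini property. Associator, unitors, braiding and twist are then defined on legs by those of
`C`, and each coherence axiom, tested on nested legs, becomes the same axiom in `C`.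
`TensorExtension` isolates the properties needed for this argument, and `indTensorExtension`
verifies them.

The abstract argument gives universal properties inside `Ind(C)`, while the theorem asks for direct
limits of weak modules. `isDirectLimit_of_ind` bridges the gap: a homomorphism from an object of
`Ind(C)` to any weak module lands in the union of the `C`-submodules of the target. -/

noncomputable section

section WeakModuleConstructions

open WeakModule

variable {V : VertexOperatorAlgebra.{u}}

/-! ### Constructions with weak modules -/

namespace WeakModule

/-! ### Both sides of the Jacobi identity under intertwining linear maps -/

section Jacobi

variable {M N : Type u} [AddCommGroup M] [Module ℂ M] [AddCommGroup N] [Module ℂ N]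

/-- The left-hand side of the Jacobi identity. -/
def jacobiLeft (Y : ℤ → V.carrier →ₗ[ℂ] M →ₗ[ℂ] M) (v₁ v₂ : V.carrier) (l m n : ℤ) (w : M) : M :=
  ∑ᶠ i : ℕ, ((-1 : ℤ) ^ i * Ring.choose l i) •
    (Y (m + l - i) v₁ (Y (n + i) v₂ w)
      - (Int.negOnePow l : ℤ) • Y (n + l - i) v₂ (Y (m + i) v₁ w))

/-- The right-hand side of the Jacobi identity. -/
def jacobiRight (Y : ℤ → V.carrier →ₗ[ℂ] M →ₗ[ℂ] M) (v₁ v₂ : V.carrier) (l m n : ℤ) (w : M) : M :=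
  ∑ᶠ i : ℕ, (Ring.choose m i) • Y (m + n - i) (V.mode (l + i) v₁ v₂) w

variable {YM : ℤ → V.carrier →ₗ[ℂ] M →ₗ[ℂ] M} {YN : ℤ → V.carrier →ₗ[ℂ] N →ₗ[ℂ] N}
  (L : M →ₗ[ℂ] N) (hL : ∀ n v x, L (YM n v x) = YN n v (L x))

-- Lower truncation in `V` itself kills `V.mode (l + i) v₁ v₂` for large `i`, so the sum is finite
-- and commutes with `L`.
include hL in
theorem map_jacobiRight (v₁ v₂ : V.carrier) (l m n : ℤ) (w : M) :
    L (jacobiRight YM v₁ v₂ l m n w) = jacobiRight YN v₁ v₂ l m n (L w) := by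
  obtain ⟨N₁, h₁⟩ := V.lower_truncation v₁ v₂
  have hfin : (Function.support fun i : ℕ =>
      (Ring.choose m i) • YM (m + n - i) (V.mode (l + i) v₁ v₂) w).Finite := by
    refine (Set.finite_lt_nat (N₁ - l).toNat).subset fun i hi => ?_
    by_contra h
    simp only [Set.mem_ofPred_eq, not_lt, Int.toNat_le] at h
    exact hi (by simp [h₁ (l + i) (by omega)])
  refine (L.toAddMonoidHom.map_finsum hfin).trans (finsum_congr fun i => ?_)
  simp [hL]

-- The inner modes act on `w` with indices `n + i` and `m + i`, so truncation at the single vector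
-- `w` makes the sum finite. Together with `map_jacobiRight` this transports the Jacobi identity to
-- quotients, products and direct limits.
include hL in
theorem map_jacobiLeft (ht : ∀ v w, ∃ k : ℤ, ∀ n ≥ k, YM n v w = 0)
    (v₁ v₂ : V.carrier) (l m n : ℤ) (w : M) :
    L (jacobiLeft YM v₁ v₂ l m n w) = jacobiLeft YN v₁ v₂ l m n (L w) := by
  obtain ⟨N₁, h₁⟩ := ht v₁ w
  obtain ⟨N₂, h₂⟩ := ht v₂ w
  have hfin : (Function.support fun i : ℕ => ((-1 : ℤ) ^ i * Ring.choose l i) •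
    (YM (m + l - i) v₁ (YM (n + i) v₂ w)
      - (Int.negOnePow l : ℤ) • YM (n + l - i) v₂ (YM (m + i) v₁ w))).Finite := by
    refine (Set.finite_lt_nat (max (N₁ - m).toNat (N₂ - n).toNat)).subset fun i hi => ?_
    by_contra h
    simp only [Set.mem_ofPred_eq, not_lt, max_le_iff, Int.toNat_le] at h
    exact hi (by simp [h₁ (m + i) (by omega), h₂ (n + i) (by omega)])
  refine (L.toAddMonoidHom.map_finsum hfin).trans (finsum_congr fun i => ?_)
  simp [hL]

end Jacobi

theorem jacobiLeft_eq_jacobiRight (X : WeakModule V) (v₁ v₂ : V.carrier) (l m n : ℤ)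
    (w : X.carrier) : jacobiLeft X.mode v₁ v₂ l m n w = jacobiRight X.mode v₁ v₂ l m n w :=
  X.jacobi v₁ v₂ w l m n

/-! ### Homomorphisms and factorization through surjections and injections -/

section Homs

variable {X Y Z : WeakModule V}

/-- A `V`-homomorphism from an intertwining linear map. -/
def ofLin (f : X.carrier →ₗ[ℂ] Y.carrier)
    (h : ∀ (n : ℤ) (v : V.carrier) (x : X.carrier), f (X.mode n v x) = Y.mode n v (f x)) :
    X ⟶ Y := ⟨f, h⟩

@[simp] theorem toLin_ofLin (f : X.carrier →ₗ[ℂ] Y.carrier) (h) :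
    toLin (ofLin f h : X ⟶ Y) = f := rfl

@[simp] theorem toLin_comp (f : X ⟶ Y) (g : Y ⟶ Z) : toLin (f ≫ g) = toLin g ∘ₗ toLin f := rfl

theorem toLin_mode (f : X ⟶ Y) (n : ℤ) (v : V.carrier) (x : X.carrier) :
    toLin f (X.mode n v x) = Y.mode n v (toLin f x) := f.2 n v x

theorem toLin_injective : Function.Injective (toLin : (X ⟶ Y) → _) := Subtype.val_injective

theorem hom_ext_apply {f g : X ⟶ Y} (h : ∀ x, toLin f x = toLin g x) : f = g :=
  toLin_injective (LinearMap.ext h)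

theorem congr_toLin {f g : X ⟶ Y} (h : f = g) (x : X.carrier) : toLin f x = toLin g x := by rw [h]

theorem epi_of_surjective (f : X ⟶ Y) (h : Function.Surjective (toLin f)) : Epi f where
  left_cancellation g g' hg := hom_ext_apply fun y => by
    obtain ⟨x, rfl⟩ := h y
    exact congr_toLin hg x

theorem mono_of_injective (f : X ⟶ Y) (h : Function.Injective (toLin f)) : Mono f where
  right_cancellation _ _ hg := hom_ext_apply fun x => h (congr_toLin hg x)

/-- Factorization through a surjection whose kernel is annihilated. -/
def descOfSurjective (p : X ⟶ Y) (hp : Function.Surjective (toLin p)) (f : X ⟶ Z)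
    (hf : LinearMap.ker (toLin p) ≤ LinearMap.ker (toLin f)) : Y ⟶ Z :=
  have key (x : X.carrier) : ((LinearMap.ker (toLin p)).liftQ (toLin f) hf ∘ₗ
      ((toLin p).quotKerEquivOfSurjective hp).symm.toLinearMap) (toLin p x) = toLin f x := by
    have : ((toLin p).quotKerEquivOfSurjective hp).symm (toLin p x) =
        (LinearMap.ker (toLin p)).mkQ x := by
      rw [LinearEquiv.symm_apply_eq]; rfl
    simp only [LinearMap.comp_apply, LinearEquiv.coe_coe, this]
    rfl
  ofLin ((LinearMap.ker (toLin p)).liftQ (toLin f) hf ∘ₗ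
      ((toLin p).quotKerEquivOfSurjective hp).symm.toLinearMap) (by
    intro n v y
    obtain ⟨x, rfl⟩ := hp y
    rw [← toLin_mode, key, key, toLin_mode])

theorem comp_descOfSurjective (p : X ⟶ Y) (hp : Function.Surjective (toLin p)) (f : X ⟶ Z)
    (hf : LinearMap.ker (toLin p) ≤ LinearMap.ker (toLin f)) :
    p ≫ descOfSurjective p hp f hf = f := by
  refine hom_ext_apply fun x => ?_
  have : ((toLin p).quotKerEquivOfSurjective hp).symm (toLin p x) =
      (LinearMap.ker (toLin p)).mkQ x := by
    rw [LinearEquiv.symm_apply_eq]; rfl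
  simp only [toLin_comp, LinearMap.comp_apply, descOfSurjective, toLin_ofLin,
    LinearEquiv.coe_coe, this]
  rfl

/-- Factorization through an injection containing the range. -/
def liftOfInjective (i : Y ⟶ Z) (hi : Function.Injective (toLin i)) (f : X ⟶ Z)
    (hf : LinearMap.range (toLin f) ≤ LinearMap.range (toLin i)) : X ⟶ Y :=
  have key (x : X.carrier) : toLin i (((LinearEquiv.ofInjective (toLin i) hi).symm.toLinearMap ∘ₗ
      (toLin f).codRestrict (LinearMap.range (toLin i)) fun x => hf ⟨x, rfl⟩) x) = toLin f x :=
    congrArg Subtype.val ((LinearEquiv.ofInjective (toLin i) hi).apply_symm_apply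
      ⟨toLin f x, hf ⟨x, rfl⟩⟩)
  ofLin ((LinearEquiv.ofInjective (toLin i) hi).symm.toLinearMap ∘ₗ
      (toLin f).codRestrict (LinearMap.range (toLin i)) fun x => hf ⟨x, rfl⟩) (by
    intro n v x
    apply hi
    rw [toLin_mode, key, key, toLin_mode])

theorem liftOfInjective_comp (i : Y ⟶ Z) (hi : Function.Injective (toLin i)) (f : X ⟶ Z)
    (hf : LinearMap.range (toLin f) ≤ LinearMap.range (toLin i)) :
    liftOfInjective i hi f hf ≫ i = f :=
  hom_ext_apply fun x => congrArg Subtype.val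
    ((LinearEquiv.ofInjective (toLin i) hi).apply_symm_apply ⟨toLin f x, hf ⟨x, rfl⟩⟩)

end Homs

/-! #### Submodules and quotients -/

namespace Sub

variable {X Y : WeakModule V}

theorem incl_injective (S : X.Sub) : Function.Injective (toLin S.incl) := Subtype.val_injective

theorem range_incl (S : X.Sub) : LinearMap.range (toLin S.incl) = S.toSubmodule :=
  Submodule.range_subtype _

instance (S : X.Sub) : Mono S.incl := mono_of_injective _ S.incl_injective

/-- The kernel of a `V`-homomorphism. -/
def ker (f : X ⟶ Y) : X.Sub where
  toSubmodule := LinearMap.ker (toLin f)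
  mode_mem n v x hx := by
    change toLin f _ = 0
    rw [toLin_mode, show toLin f x = 0 from hx, map_zero]

theorem ker_incl_comp (f : X ⟶ Y) : (ker f).incl ≫ f = 0 :=
  hom_ext_apply fun x => x.2

/-- The quotient of a weak module by a `V`-submodule. -/
def quotient (S : X.Sub) : WeakModule V where
  carrier := X.carrier ⧸ S.toSubmodule
  mode n :=
    { toFun := fun v => S.toSubmodule.mapQ S.toSubmodule (X.mode n v)
        (fun x hx => S.mode_mem n v x hx)
      map_add' := fun u v => by ext x; simp
      map_smul' := fun c v => by ext x; simp }
  lower_truncation v w := by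
    obtain ⟨x, rfl⟩ := S.toSubmodule.mkQ_surjective w
    obtain ⟨N, hN⟩ := X.lower_truncation v x
    exact ⟨N, fun n hn => by simp [hN n hn]⟩
  vacuum_property n w := by
    obtain ⟨x, rfl⟩ := S.toSubmodule.mkQ_surjective w
    have h := X.vacuum_property n x
    exact (congrArg S.toSubmodule.mkQ h).trans (by split_ifs <;> rfl)
  jacobi v₁ v₂ w l m n := by
    obtain ⟨x, rfl⟩ := S.toSubmodule.mkQ_surjective w
    let YQ : ℤ → V.carrier →ₗ[ℂ] (X.carrier ⧸ S.toSubmodule) →ₗ[ℂ] (X.carrier ⧸ S.toSubmodule) :=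
      fun n =>
        { toFun := fun v => S.toSubmodule.mapQ S.toSubmodule (X.mode n v)
            (fun x hx => S.mode_mem n v x hx)
          map_add' := fun u v => by ext x; simp
          map_smul' := fun c v => by ext x; simp }
    -- The projection intertwines the modes, so both sides of the identity in the quotient are
    -- images of the sides in `X`.
    have h : ∀ n v x, S.toSubmodule.mkQ (X.mode n v x) = YQ n v (S.toSubmodule.mkQ x) :=
      fun _ _ _ => rfl
    exact (map_jacobiLeft _ h X.lower_truncation v₁ v₂ l m n x).symm.trans
      ((congrArg _ (jacobiLeft_eq_jacobiRight X v₁ v₂ l m n x)).trans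
        (map_jacobiRight _ h v₁ v₂ l m n x))
  derivative n v w := by
    obtain ⟨x, rfl⟩ := S.toSubmodule.mkQ_surjective w
    exact congrArg S.toSubmodule.mkQ (X.derivative n v x)

/-- The projection onto the quotient by a `V`-submodule. -/
def proj (S : X.Sub) : X ⟶ S.quotient := ⟨S.toSubmodule.mkQ, fun _ _ _ => rfl⟩

theorem proj_surjective (S : X.Sub) : Function.Surjective (toLin S.proj) :=
  S.toSubmodule.mkQ_surjective

theorem ker_proj (S : X.Sub) : LinearMap.ker (toLin S.proj) = S.toSubmodule :=
  S.toSubmodule.ker_mkQ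

instance (S : X.Sub) : Epi S.proj := epi_of_surjective _ S.proj_surjective

end Sub

/-! #### Products -/

/-- The product of two weak modules. -/
def prod (X Y : WeakModule V) : WeakModule V where
  carrier := X.carrier × Y.carrier
  mode n :=
    { toFun := fun v => (X.mode n v).prodMap (Y.mode n v)
      map_add' := fun u v => by ext x <;> simp
      map_smul' := fun c v => by ext x <;> simp }
  lower_truncation v w := by
    obtain ⟨N, hN⟩ := X.lower_truncation v w.1
    obtain ⟨N', hN'⟩ := Y.lower_truncation v w.2
    refine ⟨max N N', fun n hn => Prod.ext (hN n ?_) (hN' n ?_)⟩ <;> omega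
  vacuum_property n w := by
    have h := X.vacuum_property n w.1
    have h' := Y.vacuum_property n w.2
    by_cases hn : n = -1
    · rw [if_pos hn] at *
      exact Prod.ext (x := (_, _)) h h'
    · rw [if_neg hn] at *
      exact Prod.ext (x := (_, _)) h h'
  jacobi v₁ v₂ w l m n := by
    let YP : ℤ → V.carrier →ₗ[ℂ] (X.carrier × Y.carrier) →ₗ[ℂ] (X.carrier × Y.carrier) := fun n =>
      { toFun := fun v => (X.mode n v).prodMap (Y.mode n v)
        map_add' := fun u v => by ext x <;> simp
        map_smul' := fun c v => by ext x <;> simp }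
    have ht : ∀ v w, ∃ k : ℤ, ∀ n ≥ k, YP n v w = 0 := by
      intro v w
      obtain ⟨N, hN⟩ := X.lower_truncation v w.1
      obtain ⟨N', hN'⟩ := Y.lower_truncation v w.2
      refine ⟨max N N', fun n hn => Prod.ext (hN n ?_) (hN' n ?_)⟩ <;> omega
    change jacobiLeft YP v₁ v₂ l m n w = jacobiRight YP v₁ v₂ l m n w
    -- The two projections intertwine the modes and jointly detect equality.
    have h₁ : ∀ n v x, (LinearMap.fst ℂ X.carrier Y.carrier) (YP n v x) = X.mode n v x.1 :=
      fun _ _ _ => rfl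
    have h₂ : ∀ n v x, (LinearMap.snd ℂ X.carrier Y.carrier) (YP n v x) = Y.mode n v x.2 :=
      fun _ _ _ => rfl
    refine Prod.ext ?_ ?_
    · exact (map_jacobiLeft _ h₁ ht v₁ v₂ l m n w).trans
        ((jacobiLeft_eq_jacobiRight X v₁ v₂ l m n w.1).trans
          (map_jacobiRight _ h₁ v₁ v₂ l m n w).symm)
    · exact (map_jacobiLeft _ h₂ ht v₁ v₂ l m n w).trans
        ((jacobiLeft_eq_jacobiRight Y v₁ v₂ l m n w.2).trans
          (map_jacobiRight _ h₂ v₁ v₂ l m n w).symm)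
  derivative n v w := Prod.ext (X.derivative n v w.1) (Y.derivative n v w.2)

/-- The product of two weak modules as a biproduct. -/
def prodBicone (X Y : WeakModule V) : BinaryBicone X Y where
  pt := X.prod Y
  fst := ⟨LinearMap.fst ℂ _ _, fun _ _ _ => rfl⟩
  snd := ⟨LinearMap.snd ℂ _ _, fun _ _ _ => rfl⟩
  inl := ofLin (LinearMap.inl ℂ _ _) fun n v _ => Prod.ext rfl (map_zero (Y.mode n v)).symm
  inr := ofLin (LinearMap.inr ℂ _ _) fun n v _ => Prod.ext (map_zero (X.mode n v)).symm rfl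
  inl_fst := rfl
  inl_snd := rfl
  inr_fst := rfl
  inr_snd := rfl

theorem prodBicone_total (X Y : WeakModule V) :
    (prodBicone X Y).fst ≫ (prodBicone X Y).inl + (prodBicone X Y).snd ≫ (prodBicone X Y).inr =
      𝟙 (prodBicone X Y).pt :=
  hom_ext_apply fun x => Prod.ext (add_zero x.1) (zero_add x.2)

/-- The product of two weak modules is a biproduct. -/
def prodBiconeIsBilimit (X Y : WeakModule V) : (prodBicone X Y).IsBilimit :=
  isBinaryBilimitOfTotal _ (prodBicone_total X Y)

/-! #### The category of weak modules is abelian -/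

/-- The kernel fork given by the kernel submodule. -/
def kernelIsLimit {X Y : WeakModule V} (f : X ⟶ Y) :
    IsLimit (KernelFork.ofι (Sub.ker f).incl (Sub.ker_incl_comp f)) :=
  KernelFork.IsLimit.ofι _ _
    (fun g hg => liftOfInjective _ (Sub.ker f).incl_injective g (by
      rw [Sub.range_incl]; rintro _ ⟨x, rfl⟩; exact congr_toLin hg x))
    (fun g hg => liftOfInjective_comp _ _ _ _)
    (fun g hg m hm => by rw [← cancel_mono (Sub.ker f).incl, hm, liftOfInjective_comp])

theorem comp_proj_image {X Y : WeakModule V} (f : X ⟶ Y) : f ≫ (Sub.image f).proj = 0 :=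
  hom_ext_apply fun x => (Submodule.Quotient.mk_eq_zero _).2 ⟨x, rfl⟩

/-- The cokernel cofork given by the quotient by the image. -/
def cokernelIsColimit {X Y : WeakModule V} (f : X ⟶ Y) :
    IsColimit (CokernelCofork.ofπ (Sub.image f).proj (comp_proj_image f)) :=
  CokernelCofork.IsColimit.ofπ _ _
    (fun g hg => descOfSurjective _ (Sub.image f).proj_surjective g (by
      rw [Sub.ker_proj]; rintro _ ⟨x, rfl⟩; exact congr_toLin hg x))
    (fun g hg => comp_descOfSurjective _ _ _ _)
    (fun g hg m hm => by rw [← cancel_epi (Sub.image f).proj, hm, comp_descOfSurjective])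

/-- The inclusion of the kernel is itself a homomorphism, and a monomorphism forces it to vanish.
This links the elementwise closure conditions on `C` to categorical subobjects; the epimorphism case
is dual. -/
theorem injective_of_mono {X Y : WeakModule V} (f : X ⟶ Y) [Mono f] :
    Function.Injective (toLin f) := by
  rw [← LinearMap.ker_eq_bot, eq_bot_iff]
  intro x hx
  have h : (Sub.ker f).incl = 0 := by
    rw [← cancel_mono f, Sub.ker_incl_comp, zero_comp]
  exact congr_toLin h ⟨x, hx⟩

theorem surjective_of_epi {X Y : WeakModule V} (f : X ⟶ Y) [Epi f] :
    Function.Surjective (toLin f) := by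
  have h : (Sub.image f).proj = 0 := by
    rw [← cancel_epi f, comp_proj_image, comp_zero]
  intro y
  exact (Submodule.Quotient.mk_eq_zero _).1 (congr_toLin h y)

/-- The zero weak module. -/
def zeroModule (V : VertexOperatorAlgebra.{u}) : WeakModule V where
  carrier := PUnit
  mode _ := 0
  lower_truncation _ _ := ⟨0, fun _ _ => rfl⟩
  vacuum_property _ _ := Subsingleton.elim _ _
  jacobi _ _ _ _ _ _ := Subsingleton.elim _ _
  derivative _ _ _ := Subsingleton.elim _ _

theorem isZero_of_subsingleton (X : WeakModule V) [Subsingleton X.carrier] : IsZero X :=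
  (IsZero.iff_id_eq_zero X).2 (hom_ext_apply fun _ => Subsingleton.elim _ _)

theorem isZero_zeroModule : IsZero (zeroModule V) :=
  haveI : Subsingleton (zeroModule V).carrier := inferInstanceAs (Subsingleton PUnit)
  isZero_of_subsingleton _

instance : HasZeroObject (WeakModule V) := ⟨⟨_, isZero_zeroModule⟩⟩

instance : HasBinaryBiproducts (WeakModule V) :=
  ⟨fun X Y => HasBinaryBiproduct.mk ⟨_, prodBiconeIsBilimit X Y⟩⟩

instance : HasFiniteProducts (WeakModule V) :=
  haveI : HasBinaryProducts (WeakModule V) := inferInstance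
  haveI : HasTerminal (WeakModule V) := inferInstance
  hasFiniteProducts_of_has_binary_and_terminal

instance : HasKernels (WeakModule V) := ⟨fun f => ⟨⟨_, kernelIsLimit f⟩⟩⟩

instance : HasCokernels (WeakModule V) := ⟨fun f => ⟨⟨_, cokernelIsColimit f⟩⟩⟩

/-- A monomorphism is injective, hence the kernel of the projection onto the quotient by its image.
-/
instance : IsNormalMonoCategory (WeakModule V) where
  normalMonoOfMono f _ := ⟨{
    Z := _
    g := (Sub.image f).proj
    w := comp_proj_image f
    isLimit := KernelFork.IsLimit.ofι _ _
      (fun g hg => liftOfInjective f (injective_of_mono f) g (by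
        rintro _ ⟨x, rfl⟩
        exact (Submodule.Quotient.mk_eq_zero _).1 (congr_toLin hg x)))
      (fun g hg => liftOfInjective_comp _ _ _ _)
      (fun g hg m hm => by rw [← cancel_mono f, hm, liftOfInjective_comp]) }⟩

/-- An epimorphism is surjective, hence the cokernel of the inclusion of its kernel. -/
instance : IsNormalEpiCategory (WeakModule V) where
  normalEpiOfEpi f _ := ⟨{
    W := _
    g := (Sub.ker f).incl
    w := Sub.ker_incl_comp f
    isColimit := CokernelCofork.IsColimit.ofπ _ _
      (fun g hg => descOfSurjective f (surjective_of_epi f) g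
        (fun x hx => congr_toLin hg ⟨x, hx⟩))
      (fun g hg => comp_descOfSurjective _ _ _ _)
      (fun g hg m hm => by
        rw [← cancel_epi f, hm]; exact (comp_descOfSurjective _ _ _ _).symm) }⟩

instance : Abelian (WeakModule V) where

/-! #### Direct limits -/

section DirectLimit

variable {J : Type u} [Preorder J] (F : J ⥤ WeakModule V)

open scoped Classical

/-- The transition maps of a directed system of weak modules. -/
def transitionLin (i j : J) (h : i ≤ j) : (F.obj i).carrier →ₗ[ℂ] (F.obj j).carrier :=
  toLin (F.map (homOfLE h))

/-- The underlying vector space of the direct limit of a directed system of weak modules. -/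
abbrev DirectLimitCarrier : Type u :=
  Module.DirectLimit (fun j => (F.obj j).carrier) (transitionLin F)

/-- The canonical linear maps into the direct limit. -/
abbrev directLimitOf (j : J) : (F.obj j).carrier →ₗ[ℂ] DirectLimitCarrier F :=
  Module.DirectLimit.of ℂ J (fun j => (F.obj j).carrier) (transitionLin F) j

/-- The modes acting on the direct limit. -/
def directLimitMode (n : ℤ) :
    V.carrier →ₗ[ℂ] DirectLimitCarrier F →ₗ[ℂ] DirectLimitCarrier F where
  toFun v := Module.DirectLimit.map (fun j => (F.obj j).mode n v)
    (fun i j h => LinearMap.ext fun x => (toLin_mode (F.map (homOfLE h)) n v x).symm)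
  map_add' u v := Module.DirectLimit.hom_ext fun j => LinearMap.ext fun x => by simp
  map_smul' c v := Module.DirectLimit.hom_ext fun j => LinearMap.ext fun x => by simp

theorem directLimitOf_mode (j : J) (n : ℤ) (v : V.carrier) (x : (F.obj j).carrier) :
    directLimitOf F j ((F.obj j).mode n v x) = directLimitMode F n v (directLimitOf F j x) :=
  (Module.DirectLimit.map_apply_of (fun j => (F.obj j).mode n v)
    (fun _ _ h => LinearMap.ext fun x => (toLin_mode (F.map (homOfLE h)) n v x).symm) x).symm

variable {F} in
/-- The linear map from the direct limit given by a cocone. -/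
def directLimitDesc (s : Cocone F) : DirectLimitCarrier F →ₗ[ℂ] s.pt.carrier :=
  Module.DirectLimit.lift ℂ J (fun j => (F.obj j).carrier) (transitionLin F)
    (fun j => toLin (s.ι.app j)) fun _ _ h x => congr_toLin (s.w (homOfLE h)) x

variable {F} in
theorem directLimitDesc_of (s : Cocone F) (j : J) (x : (F.obj j).carrier) :
    directLimitDesc s (directLimitOf F j x) = toLin (s.ι.app j) x :=
  Module.DirectLimit.lift_of (R := ℂ) (G := fun j => (F.obj j).carrier) (f := transitionLin F)
    (fun j => toLin (s.ι.app j)) (fun _ _ h x => congr_toLin (s.w (homOfLE h)) x) x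

variable [Nonempty J] [IsDirectedOrder J]

theorem exists_directLimitOf (z : DirectLimitCarrier F) : ∃ j x, directLimitOf F j x = z :=
  Module.DirectLimit.exists_of z

/-- The direct limit of a directed system of weak modules. -/
def directLimit : WeakModule V where
  carrier := DirectLimitCarrier F
  mode := directLimitMode F
  lower_truncation v w := by
    obtain ⟨j, x, rfl⟩ := exists_directLimitOf F w
    obtain ⟨N, hN⟩ := (F.obj j).lower_truncation v x
    exact ⟨N, fun n hn => by rw [← directLimitOf_mode, hN n hn, map_zero]⟩
  vacuum_property n w := by
    obtain ⟨j, x, rfl⟩ := exists_directLimitOf F w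
    rw [← directLimitOf_mode, (F.obj j).vacuum_property]
    split_ifs <;> simp
  jacobi v₁ v₂ w l m n := by
    obtain ⟨j, x, rfl⟩ := exists_directLimitOf F w
    exact (map_jacobiLeft _ (directLimitOf_mode F j) (F.obj j).lower_truncation
        v₁ v₂ l m n x).symm.trans
      ((congrArg _ (jacobiLeft_eq_jacobiRight _ v₁ v₂ l m n x)).trans
        (map_jacobiRight _ (directLimitOf_mode F j) v₁ v₂ l m n x))
  derivative n v w := by
    obtain ⟨j, x, rfl⟩ := exists_directLimitOf F w
    rw [← directLimitOf_mode, ← directLimitOf_mode, (F.obj j).derivative, map_smul]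

/-- The canonical homomorphisms into the direct limit. -/
def directLimitι (j : J) : F.obj j ⟶ directLimit F :=
  ofLin (directLimitOf F j) (directLimitOf_mode F j)

theorem map_directLimitι {i j : J} (h : i ⟶ j) : F.map h ≫ directLimitι F j = directLimitι F i :=
  hom_ext_apply fun x => by
    have := Module.DirectLimit.of_f (R := ℂ) (G := fun j => (F.obj j).carrier)
      (f := transitionLin F) (hij := leOfHom h) (x := x)
    exact this

/-- The direct limit as a cocone. -/
def directLimitCocone : Cocone F where
  pt := directLimit F
  ι :=
    { app := directLimitι F
      naturality _ _ h := (map_directLimitι F h).trans (Category.comp_id _).symm }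

/-- The direct limit is a colimit. -/
def directLimitIsColimit : IsColimit (directLimitCocone F) where
  desc s := ofLin (directLimitDesc s) (by
    intro n v z
    obtain ⟨j, x, rfl⟩ := exists_directLimitOf F z
    refine (congrArg _ (directLimitOf_mode F j n v x).symm).trans ?_
    exact (directLimitDesc_of s j _).trans ((toLin_mode _ _ _ _).trans
      (congrArg _ (directLimitDesc_of s j x).symm)))
  fac s j := hom_ext_apply fun x => directLimitDesc_of s j x
  uniq s m hm := hom_ext_apply fun z => by
    obtain ⟨j, x, rfl⟩ := exists_directLimitOf F z
    exact (congr_toLin (hm j) x).trans (directLimitDesc_of s j x).symm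

/-- The functor laws in elementwise form, as needed to conclude that an element vanishing in the
direct limit vanishes at some stage. -/
instance directedSystem_transitionLin : DirectedSystem (fun j => (F.obj j).carrier)
    (transitionLin F · · ·) where
  map_self i x := by
    have : homOfLE (le_refl i) = 𝟙 i := rfl
    rw [transitionLin, this, F.map_id]; rfl
  map_map i j k hij hjk x := by
    exact (congr_toLin (F.map_comp (homOfLE hij) (homOfLE hjk)) x).symm

end DirectLimit

/-! ### Elements of an arbitrary directed colimit -/

section IsColimit

variable {J : Type u} [Preorder J] [Nonempty J] [IsDirectedOrder J] {F : J ⥤ WeakModule V}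
  {c : Cocone F} (hc : IsColimit c)

include hc

/-- True for the concrete direct limit, and carried over by the unique isomorphism of colimits. The
next lemma is obtained in the same way. -/
theorem exists_of_isColimit (x : c.pt.carrier) : ∃ j y, toLin (c.ι.app j) y = x := by
  let e := hc.coconePointUniqueUpToIso (directLimitIsColimit F)
  obtain ⟨j, y, hy⟩ := exists_directLimitOf F (toLin e.hom x)
  refine ⟨j, y, ?_⟩
  have h₁ : directLimitι F j ≫ e.inv = c.ι.app j :=
    hc.comp_coconePointUniqueUpToIso_inv (directLimitIsColimit F) j
  rw [← h₁]
  exact (congrArg (toLin e.inv) hy).trans (congr_toLin e.hom_inv_id x)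

theorem exists_map_eq_zero_of_isColimit {j : J} (y : (F.obj j).carrier)
    (h : toLin (c.ι.app j) y = 0) : ∃ (k : J) (f : j ⟶ k), toLin (F.map f) y = 0 := by
  classical
  let e := hc.coconePointUniqueUpToIso (directLimitIsColimit F)
  have h₁ : c.ι.app j ≫ e.hom = directLimitι F j :=
    hc.comp_coconePointUniqueUpToIso_hom (directLimitIsColimit F) j
  have h₂ : directLimitOf F j y = 0 := by
    refine (congr_toLin h₁ y).symm.trans ?_
    exact (congrArg (toLin e.hom) h).trans (map_zero _)
  obtain ⟨k, hk, h₃⟩ := Module.DirectLimit.of.zero_exact h₂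
  exact ⟨k, homOfLE hk, h₃⟩

end IsColimit

end WeakModule

end WeakModuleConstructions

section IndCompletion

open WeakModule

variable {V : VertexOperatorAlgebra.{u}}

namespace WeakModule

variable {X Y Z : WeakModule V}

/-- The first projection. -/
def prodFst (X Y : WeakModule V) : X.prod Y ⟶ X := (prodBicone X Y).fst

/-- The second projection. -/
def prodSnd (X Y : WeakModule V) : X.prod Y ⟶ Y := (prodBicone X Y).snd

/-- The homomorphism from a product given by its components. -/
def prodDesc (f : X ⟶ Z) (g : Y ⟶ Z) : X.prod Y ⟶ Z := prodFst X Y ≫ f + prodSnd X Y ≫ g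

/-- The homomorphism to a product given by its components. -/
def prodLift (f : Z ⟶ X) (g : Z ⟶ Y) : Z ⟶ X.prod Y :=
  f ≫ (prodBicone X Y).inl + g ≫ (prodBicone X Y).inr

theorem inl_prodDesc (f : X ⟶ Z) (g : Y ⟶ Z) : (prodBicone X Y).inl ≫ prodDesc f g = f :=
  hom_ext_apply fun x => (congrArg (toLin f x + ·) (map_zero (toLin g))).trans (add_zero _)

theorem inr_prodDesc (f : X ⟶ Z) (g : Y ⟶ Z) : (prodBicone X Y).inr ≫ prodDesc f g = g :=
  hom_ext_apply fun x => (congrArg (· + toLin g x) (map_zero (toLin f))).trans (zero_add _)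

theorem prodLift_fst (f : Z ⟶ X) (g : Z ⟶ Y) : prodLift f g ≫ prodFst X Y = f :=
  hom_ext_apply fun _ => add_zero _

theorem prodLift_snd (f : Z ⟶ X) (g : Z ⟶ Y) : prodLift f g ≫ prodSnd X Y = g :=
  hom_ext_apply fun _ => zero_add _

end WeakModule

/-! ### `C`-submodules and the direct limit completion -/

namespace IsAdmissible

variable {C : ObjectProperty (WeakModule V)} (hC : IsAdmissible C)

include hC

theorem prod {X Y : WeakModule V} (hX : C X) (hY : C Y) : C (X.prod Y) :=
  hC.directSums (prodBicone X Y) ⟨prodBiconeIsBilimit X Y⟩ hX hY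

theorem sub {X : WeakModule V} (hX : C X) (S : X.Sub) : C S.toModule :=
  hC.submodules S.incl S.incl_injective hX

end IsAdmissible

namespace CSub

variable {C : ObjectProperty (WeakModule V)} {X Y : WeakModule V}

theorem incl_injective (W : CSub C X) : Function.Injective (toLin W.incl) := W.1.incl_injective

theorem image_le (hC : IsAdmissible C) {W : C.FullSubcategory} (f : W.obj ⟶ X) (S : CSub C X)
    (g : W ⟶ S.obj) (h : g.hom ≫ S.incl = f) : image hC f ≤ S := by
  rintro _ ⟨w, rfl⟩
  subst h
  exact (toLin g.hom w).2

theorem le_image (hC : IsAdmissible C) {W : C.FullSubcategory} (f : W.obj ⟶ X) (S : CSub C X)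
    (g : S.obj ⟶ W) (h : g.hom ≫ f = S.incl) : S ≤ image hC f :=
  fun x hx => ⟨toLin g.hom ⟨x, hx⟩, congr_toLin h ⟨x, hx⟩⟩

/-- The sum `S + T` is the image of the direct sum of `S` and `T`, so closure under finite direct
sums and quotients puts it in `C`. -/
theorem exists_ge_ge (hC : IsAdmissible C) (S T : CSub C X) : ∃ R : CSub C X, S ≤ R ∧ T ≤ R := by
  let P : C.FullSubcategory := ⟨_, hC.prod S.2 T.2⟩
  let f : P.obj ⟶ X := prodDesc S.incl T.incl
  refine ⟨image hC f, le_image hC f S (ObjectProperty.homMk (prodBicone _ _).inl) ?_,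
    le_image hC f T (ObjectProperty.homMk (prodBicone _ _).inr) ?_⟩
  · exact inl_prodDesc _ _
  · exact inr_prodDesc _ _

theorem isDirectedOrder (hC : IsAdmissible C) (X : WeakModule V) : IsDirectedOrder (CSub C X) :=
  ⟨exists_ge_ge hC⟩

theorem nonempty (hC : IsAdmissible C) (X : WeakModule V) : Nonempty (CSub C X) := by
  obtain ⟨Z, _, h⟩ := hC.zero
  exact ⟨image hC (W := ⟨Z, h⟩) 0⟩

/-- The preimage of a `C`-submodule under an injection. -/
theorem exists_preimage (hC : IsAdmissible C) (f : X ⟶ Y) (hf : Function.Injective (toLin f))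
    (W : CSub C Y) : ∃ S : CSub C X, ∀ x, toLin f x ∈ W.1.toSubmodule → x ∈ S.1.toSubmodule := by
  let S : X.Sub := ⟨W.1.toSubmodule.comap (toLin f), fun n v x hx => by
    change toLin f _ ∈ W.1.toSubmodule
    rw [toLin_mode]
    exact W.1.mode_mem n v _ hx⟩
  -- Restricted to the preimage, `f` is an injection into `W`, so closure under submodules applies.
  have hr : LinearMap.range (toLin (S.incl ≫ f)) ≤ LinearMap.range (toLin W.1.incl) := by
    rw [Sub.range_incl]
    rintro _ ⟨x, rfl⟩
    exact x.2
  let g : S.toModule ⟶ W.1.toModule := liftOfInjective W.1.incl W.1.incl_injective (S.incl ≫ f) hr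
  refine ⟨⟨S, hC.submodules g ?_ W.2⟩, fun x hx => hx⟩
  have h : Function.Injective (toLin (S.incl ≫ f)) := hf.comp S.incl_injective
  rw [← liftOfInjective_comp W.1.incl W.1.incl_injective (S.incl ≫ f) hr] at h
  exact Function.Injective.of_comp (f := toLin W.1.incl) h

/-- The directed system of all `C`-submodules. -/
def system (C : ObjectProperty (WeakModule V)) (X : WeakModule V) :
    CSub C X ⥤ C.FullSubcategory where
  obj W := W.obj
  map f := transition (leOfHom f)
  map_id _ := rfl
  map_comp _ _ := rfl

/-- The inclusions as a cocone on the system of all `C`-submodules. -/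
def systemCocone (C : ObjectProperty (WeakModule V)) (X : WeakModule V) :
    Cocone (system C X ⋙ C.ι) where
  pt := X
  ι :=
    { app := fun W => W.incl
      naturality _ _ _ := rfl }

end CSub

/-- A cocone which is elementwise a direct limit is a colimit. -/
theorem WeakModule.isColimit_of_elementwise {J : Type u} [Preorder J] [Nonempty J]
    [IsDirectedOrder J] {F : J ⥤ WeakModule V} (c : Cocone F)
    (hsurj : ∀ x : c.pt.carrier, ∃ j y, toLin (c.ι.app j) y = x)
    (hinj : ∀ (j : J) (y : (F.obj j).carrier), toLin (c.ι.app j) y = 0 →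
      ∃ (k : J) (f : j ⟶ k), toLin (F.map f) y = 0) : Nonempty (IsColimit c) := by
  let d := (directLimitIsColimit F).desc c
  have hd : ∀ j x, toLin d (directLimitOf F j x) = toLin (c.ι.app j) x := fun j x =>
    congr_toLin ((directLimitIsColimit F).fac c j) x
  -- The comparison map from the concrete direct limit is shown to be both epi and mono; in an
  -- abelian category it is then invertible.
  have : Epi d := epi_of_surjective _ fun x => by
    obtain ⟨j, y, rfl⟩ := hsurj x
    exact ⟨_, hd j y⟩
  have : Mono d := mono_of_injective _ <| by
    rw [← LinearMap.ker_eq_bot, eq_bot_iff]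
    intro z hz
    obtain ⟨j, y, rfl⟩ := exists_directLimitOf F z
    obtain ⟨k, f, h⟩ := hinj j y ((hd j y).symm.trans hz)
    refine (congr_toLin (map_directLimitι F f) y).symm.trans ?_
    exact (congrArg (toLin (directLimitι F k)) h).trans (map_zero _)
  have : IsIso ((directLimitIsColimit F).desc c) := isIso_of_mono_of_epi d
  exact ⟨IsColimit.ofPointIso (directLimitIsColimit F)⟩

/-- The inclusions are injective, so an element of a stage that vanishes in `X` is already zero; the
hypothesis supplies surjectivity. -/
theorem CSub.nonempty_isColimit_systemCocone {C : ObjectProperty (WeakModule V)}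
    (hC : IsAdmissible C) {X : WeakModule V}
    (h : ∀ x : X.carrier, ∃ W : CSub C X, x ∈ W.1.toSubmodule) :
    Nonempty (IsColimit (systemCocone C X)) := by
  have := CSub.nonempty hC X
  have := CSub.isDirectedOrder hC X
  refine isColimit_of_elementwise _ (fun x => ?_) fun W y hy => ⟨W, 𝟙 _, ?_⟩
  · obtain ⟨W, hW⟩ := h x
    exact ⟨W, ⟨x, hW⟩, rfl⟩
  · exact W.incl_injective (hy.trans (map_zero (toLin W.incl)).symm)

/-! ### Elementwise description and closure properties of `Ind(C)` -/

section Ind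

variable {C : ObjectProperty (WeakModule V)} (hC : IsAdmissible C)

include hC

/-- `Ind(C)` consists of the weak modules which are unions of `C`-submodules. -/
theorem indCompletion_iff (X : WeakModule V) :
    IndCompletion C X ↔ ∀ x : X.carrier, ∃ W : CSub C X, x ∈ W.1.toSubmodule := by
  constructor
  -- Every element comes from a stage, whose image is a quotient of an object of `C`.
  · rintro ⟨J, _, _, _, F, φ, c, _, ⟨hc⟩⟩ x
    obtain ⟨j, y, hy⟩ := exists_of_isColimit hc x
    exact ⟨CSub.image hC (W := F.obj j) (c.app j), ⟨y, hy⟩⟩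
  · intro h
    exact ⟨CSub C X, inferInstance, CSub.nonempty hC X, CSub.isDirectedOrder hC X,
      CSub.system C X, fun W => W.incl, (CSub.systemCocone C X).ι, fun _ => rfl,
      CSub.nonempty_isColimit_systemCocone hC h⟩

theorem IsAdmissible.le_indCompletion : C ≤ IndCompletion C := fun X hX =>
  (indCompletion_iff hC X).2 fun x => ⟨CSub.image hC (W := ⟨X, hX⟩) (𝟙 X), x, rfl⟩

/-- A `C`-submodule containing the image of `x` pulls back to a `C`-submodule containing `x`. -/
theorem indCompletion_of_injective {X Y : WeakModule V} (f : X ⟶ Y)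
    (hf : Function.Injective (toLin f)) (hY : IndCompletion C Y) : IndCompletion C X := by
  rw [indCompletion_iff hC] at hY ⊢
  intro x
  obtain ⟨W, hW⟩ := hY (toLin f x)
  obtain ⟨S, hS⟩ := CSub.exists_preimage hC f hf W
  exact ⟨S, hS x hW⟩

theorem indCompletion_of_surjective {X Y : WeakModule V} (f : X ⟶ Y)
    (hf : Function.Surjective (toLin f)) (hX : IndCompletion C X) : IndCompletion C Y := by
  rw [indCompletion_iff hC] at hX ⊢
  intro y
  obtain ⟨x, rfl⟩ := hf y
  obtain ⟨W, hW⟩ := hX x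
  exact ⟨W.map hC f, ⟨x, hW⟩, rfl⟩

theorem indCompletion_prod {X Y : WeakModule V} (hX : IndCompletion C X) (hY : IndCompletion C Y) :
    IndCompletion C (X.prod Y) := by
  rw [indCompletion_iff hC] at hX hY ⊢
  rintro ⟨x, y⟩
  obtain ⟨W, hW⟩ := hX x
  obtain ⟨W', hW'⟩ := hY y
  let f : W.1.toModule.prod W'.1.toModule ⟶ X.prod Y :=
    ofLin ((toLin W.incl).prodMap (toLin W'.incl)) fun _ _ _ => rfl
  exact ⟨CSub.image hC (W := ⟨_, hC.prod W.2 W'.2⟩) f, (⟨x, hW⟩, ⟨y, hW'⟩), rfl⟩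

theorem indCompletion_directLimit {J : Type u} [Preorder J] [Nonempty J] [IsDirectedOrder J]
    (F : J ⥤ WeakModule V) (hF : ∀ j, C (F.obj j)) : IndCompletion C (directLimit F) := by
  rw [indCompletion_iff hC]
  intro z
  obtain ⟨j, x, rfl⟩ := exists_directLimitOf F z
  exact ⟨CSub.image hC (W := ⟨_, hF j⟩) (directLimitι F j), x, rfl⟩

/-- A full subcategory of an abelian category containing zero and closed under subobjects, quotients
and finite products is abelian. The equation says that the additive structure is the inherited one.
-/
theorem abelian_indCompletion : ∃ A : Abelian (IndCompletion C).FullSubcategory,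
    A.toPreadditive = Preadditive.fullSubcategory (IndCompletion C) := by
  have : (IndCompletion C).IsClosedUnderSubobjects :=
    ⟨fun f _ hY => indCompletion_of_injective hC f (injective_of_mono f) hY⟩
  have : (IndCompletion C).IsClosedUnderQuotients :=
    ⟨fun f _ hX => indCompletion_of_surjective hC f (surjective_of_epi f) hX⟩
  have : (IndCompletion C).ContainsZero := by
    obtain ⟨Z, hZ, h⟩ := hC.zero
    exact ⟨Z, hZ, hC.le_indCompletion Z h⟩
  have : (IndCompletion C).IsClosedUnderBinaryProducts := ⟨by
    rintro X ⟨p⟩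
    have h₁ := p.prop_diag_obj ⟨WalkingPair.left⟩
    have h₂ := p.prop_diag_obj ⟨WalkingPair.right⟩
    let f₁ : X ⟶ p.diag.obj ⟨WalkingPair.left⟩ := p.π.app ⟨WalkingPair.left⟩
    let f₂ : X ⟶ p.diag.obj ⟨WalkingPair.right⟩ := p.π.app ⟨WalkingPair.right⟩
    let f := prodLift f₁ f₂
    -- `X` is an arbitrary product of the two objects. A monomorphism into the concrete product
    -- suffices, because `Ind(C)` is closed under submodules.
    have : Mono f := ⟨fun g g' h => p.isLimit.hom_ext (by
      rintro ⟨_ | _⟩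
      · change g ≫ f₁ = g' ≫ f₁
        rw [← prodLift_fst f₁ f₂, reassoc_of% h]
      · change g ≫ f₂ = g' ≫ f₂
        rw [← prodLift_snd f₁ f₂, reassoc_of% h])⟩
    exact indCompletion_of_injective hC f (injective_of_mono f) (indCompletion_prod hC h₁ h₂)⟩
  have : (IndCompletion C).IsClosedUnderFiniteProducts := ObjectProperty.IsClosedUnderFiniteProducts.mk'
  exact ⟨inferInstance, rfl⟩

end Ind

/-! ### Finitely generated modules and direct limits -/

section Compact

variable {J : Type u} [Preorder J] [Nonempty J] [IsDirectedOrder J] {F : J ⥤ WeakModule V}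
  {c : Cocone F} (hc : IsColimit c)

include hc

/-- Finitely many generators have images coming from one common stage. The preimage of the image of
that stage is a submodule containing the generators, hence everything. -/
theorem WeakModule.IsFinitelyGenerated.exists_range_le {D : WeakModule V}
    (hD : D.IsFinitelyGenerated) (f : D ⟶ c.pt) :
    ∃ j, LinearMap.range (toLin f) ≤ LinearMap.range (toLin (c.ι.app j)) := by
  classical
  obtain ⟨S, hS⟩ := hD
  choose j y hy using fun x => exists_of_isColimit hc (toLin f x)
  obtain ⟨k, hk⟩ := (S.image j).exists_le
  let N : D.Sub := ⟨(LinearMap.range (toLin (c.ι.app k))).comap (toLin f), fun n v x hx => by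
    change toLin f _ ∈ (Sub.image (c.ι.app k)).toSubmodule
    rw [toLin_mode]
    exact (Sub.image (c.ι.app k)).mode_mem n v _ hx⟩
  have hN := hS N fun s hs => ⟨toLin (F.map (homOfLE (hk _ (Finset.mem_image_of_mem j hs)))) (y s),
    (congr_toLin (c.w _) (y s)).trans (hy s)⟩
  refine ⟨k, ?_⟩
  rintro _ ⟨x, rfl⟩
  have hx : x ∈ N.toSubmodule := hN ▸ Submodule.mem_top
  exact hx

/-- Each of finitely many generators is killed at some stage. Beyond a common bound, the kernel of
the composite contains all generators. -/
theorem WeakModule.IsFinitelyGenerated.exists_comp_map_eq_zero {D : WeakModule V}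
    (hD : D.IsFinitelyGenerated) {j : J} (f : D ⟶ F.obj j) (hf : f ≫ c.ι.app j = 0) :
    ∃ (k : J) (g : j ⟶ k), f ≫ F.map g = 0 := by
  classical
  obtain ⟨S, hS⟩ := hD
  choose i h hi using fun x => exists_map_eq_zero_of_isColimit hc (toLin f x) (congr_toLin hf x)
  -- Inserting `j` guarantees `j ≤ k` even when the generating set is empty.
  obtain ⟨k, hk⟩ := (insert j (S.image i)).exists_le
  have hjk : j ≤ k := hk j (Finset.mem_insert_self _ _)
  have hN := hS (Sub.ker (f ≫ F.map (homOfLE hjk))) fun s hs => by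
    have hik : i s ≤ k := hk _ (Finset.mem_insert_of_mem (Finset.mem_image_of_mem i hs))
    have : F.map (homOfLE hjk) = F.map (h s) ≫ F.map (homOfLE hik) := by
      rw [← F.map_comp]; rfl
    change toLin (f ≫ F.map (homOfLE hjk)) s = 0
    rw [this]
    exact (congrArg (toLin (F.map (homOfLE hik))) (hi s)).trans (map_zero _)
  refine ⟨k, homOfLE hjk, hom_ext_apply fun x => ?_⟩
  have hx : x ∈ (Sub.ker (f ≫ F.map (homOfLE hjk))).toSubmodule := hN ▸ Submodule.mem_top
  exact hx

variable {C : ObjectProperty (WeakModule V)} (hC : IsAdmissible C)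

include hC

theorem IsAdmissible.exists_comp_map_eq {D : WeakModule V} (hD : C D) {j : J} (f g : D ⟶ F.obj j)
    (h : f ≫ c.ι.app j = g ≫ c.ι.app j) : ∃ (k : J) (i : j ⟶ k), f ≫ F.map i = g ≫ F.map i := by
  obtain ⟨k, i, hi⟩ := (hC.finitelyGenerated D hD).exists_comp_map_eq_zero hc (f - g)
    (by rw [Preadditive.sub_comp, h, sub_self])
  exact ⟨k, i, by rwa [Preadditive.sub_comp, sub_eq_zero] at hi⟩

/-- Finite generation alone only places the range of `f` inside the image of a stage. To lift `f`,
form the fibre product `P` of `D` and `F.obj j` over the colimit, which projects onto `D`. The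
kernel of this projection lies in `C`, hence is finitely generated, and it dies in the colimit. It
therefore dies at a later stage, where the other projection descends to `D`. -/
theorem IsAdmissible.exists_factor (hF : ∀ j, C (F.obj j)) {D : WeakModule V} (hD : C D)
    (f : D ⟶ c.pt) : ∃ (j : J) (g : D ⟶ F.obj j), g ≫ c.ι.app j = f := by
  obtain ⟨j, hj⟩ := (hC.finitelyGenerated D hD).exists_range_le hc f
  let ι : F.obj j ⟶ c.pt := c.ι.app j
  -- The fibre product as an equalizer; it is a submodule of an object of `C`.
  let P := Sub.ker (prodFst D (F.obj j) ≫ f - prodSnd D (F.obj j) ≫ ι)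
  have hP : C P.toModule := hC.sub (hC.prod hD (hF j)) P
  let p : P.toModule ⟶ D := P.incl ≫ prodFst D (F.obj j)
  let q : P.toModule ⟶ F.obj j := P.incl ≫ prodSnd D (F.obj j)
  have hpq : p ≫ f = q ≫ ι := by
    have := Sub.ker_incl_comp (prodFst D (F.obj j) ≫ f - prodSnd D (F.obj j) ≫ ι)
    rw [Preadditive.comp_sub, sub_eq_zero] at this
    simpa only [p, q, Category.assoc] using this
  have hp : Function.Surjective (toLin p) := by
    intro x
    obtain ⟨y, hy⟩ := hj ⟨x, rfl⟩
    exact ⟨⟨(x, y), sub_eq_zero.2 hy.symm⟩, rfl⟩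
  obtain ⟨k, i, hi⟩ := (hC.finitelyGenerated _ (hC.sub hP (Sub.ker p))).exists_comp_map_eq_zero hc
    ((Sub.ker p).incl ≫ q)
    (by
      change ((Sub.ker p).incl ≫ q) ≫ ι = 0
      rw [Category.assoc, ← hpq, ← Category.assoc, Sub.ker_incl_comp, zero_comp])
  have := epi_of_surjective p hp
  let d := descOfSurjective p hp (q ≫ F.map i) fun x hx => congr_toLin hi ⟨x, hx⟩
  have hd : p ≫ d = q ≫ F.map i := comp_descOfSurjective _ _ _ _
  refine ⟨k, d, ?_⟩
  rw [← cancel_epi p, ← Category.assoc, hd, Category.assoc, c.w, hpq]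

end Compact

end IndCompletion

/-! ### Extending a tensor product along a dense functor -/

universe v₁ v₂ u₁ u₂

/-- A tensor product on `𝒟` extending the one of `𝒞` along a fully faithful functor `J`: the object
`X ⊠ Y` is the colimit of the `A ⊠ B` over all `f : J A ⟶ X` and `g : J B ⟶ Y`, and this colimit is
respected by homomorphisms out of objects of `𝒞`. -/
structure TensorExtension {𝒞 : Type u₁} [Category.{v₁} 𝒞] [MonoidalCategory 𝒞]
    {𝒟 : Type u₂} [Category.{v₂} 𝒟] (J : 𝒞 ⥤ 𝒟) where
  /-- the tensor product of objects -/
  obj : 𝒟 → 𝒟 → 𝒟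
  /-- the canonical morphism `J (A ⊗ B) ⟶ X ⊠ Y` given by `f : J A ⟶ X` and `g : J B ⟶ Y` -/
  leg : ∀ {X Y : 𝒟} {A B : 𝒞}, (J.obj A ⟶ X) → (J.obj B ⟶ Y) → (J.obj (A ⊗ B) ⟶ obj X Y)
  map_leg : ∀ {X Y : 𝒟} {A B A' B' : 𝒞} (a : A ⟶ A') (b : B ⟶ B') (f : J.obj A' ⟶ X)
    (g : J.obj B' ⟶ Y), J.map (a ⊗ₘ b) ≫ leg f g = leg (J.map a ≫ f) (J.map b ≫ g)
  exists_desc : ∀ {X Y Z : 𝒟}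
    (ψ : ∀ {A B : 𝒞}, (J.obj A ⟶ X) → (J.obj B ⟶ Y) → (J.obj (A ⊗ B) ⟶ Z)),
    (∀ {A B A' B' : 𝒞} (a : A ⟶ A') (b : B ⟶ B') (f : J.obj A' ⟶ X) (g : J.obj B' ⟶ Y),
      J.map (a ⊗ₘ b) ≫ ψ f g = ψ (J.map a ≫ f) (J.map b ≫ g)) →
    ∃ u : obj X Y ⟶ Z, ∀ {A B : 𝒞} (f : J.obj A ⟶ X) (g : J.obj B ⟶ Y), leg f g ≫ u = ψ f g
  hom_ext : ∀ {X Y Z : 𝒟} {u v : obj X Y ⟶ Z},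
    (∀ {A B : 𝒞} (f : J.obj A ⟶ X) (g : J.obj B ⟶ Y), leg f g ≫ u = leg f g ≫ v) → u = v
  -- This field and the next express compactness: maps from `D` into the colimit are represented at
  -- some stage, and two representatives of one map become equal at a common later stage.
  exists_factor : ∀ {X Y : 𝒟} {D : 𝒞} (k : J.obj D ⟶ obj X Y),
    ∃ (A B : 𝒞) (f : J.obj A ⟶ X) (g : J.obj B ⟶ Y) (d : D ⟶ A ⊗ B), k = J.map d ≫ leg f g
  exists_refine : ∀ {X Y : 𝒟} {D A B A' B' : 𝒞} (f : J.obj A ⟶ X) (g : J.obj B ⟶ Y)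
    (f' : J.obj A' ⟶ X) (g' : J.obj B' ⟶ Y) (d : D ⟶ A ⊗ B) (d' : D ⟶ A' ⊗ B'),
    J.map d ≫ leg f g = J.map d' ≫ leg f' g' →
    ∃ (A'' B'' : 𝒞) (f'' : J.obj A'' ⟶ X) (g'' : J.obj B'' ⟶ Y) (a : A ⟶ A'') (b : B ⟶ B'')
      (a' : A' ⟶ A'') (b' : B' ⟶ B''), J.map a ≫ f'' = f ∧ J.map b ≫ g'' = g ∧
      J.map a' ≫ f'' = f' ∧ J.map b' ≫ g'' = g' ∧ d ≫ (a ⊗ₘ b) = d' ≫ (a' ⊗ₘ b')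
  exists_desc_obj : ∀ {X Z : 𝒟} (ψ : ∀ {A : 𝒞}, (J.obj A ⟶ X) → (J.obj A ⟶ Z)),
    (∀ {A A' : 𝒞} (a : A ⟶ A') (f : J.obj A' ⟶ X), J.map a ≫ ψ f = ψ (J.map a ≫ f)) →
    ∃ u : X ⟶ Z, ∀ {A : 𝒞} (f : J.obj A ⟶ X), f ≫ u = ψ f
  hom_ext_obj : ∀ {X Z : 𝒟} {u v : X ⟶ Z},
    (∀ {A : 𝒞} (f : J.obj A ⟶ X), f ≫ u = f ≫ v) → u = v
  /-- the unit object -/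
  unit : 𝒟
  /-- the unit object comes from `𝒞` -/
  unitIso : J.obj (𝟙_ 𝒞) ≅ unit

namespace TensorExtension

variable {𝒞 : Type u₁} [Category.{v₁} 𝒞] [MonoidalCategory 𝒞]
  {𝒟 : Type u₂} [Category.{v₂} 𝒟] {J : 𝒞 ⥤ 𝒟} (T : TensorExtension J)

theorem leg_map_left {X Y : 𝒟} {A B A' : 𝒞} (a : A ⟶ A') (f : J.obj A' ⟶ X) (g : J.obj B ⟶ Y) :
    T.leg (J.map a ≫ f) g = J.map (a ▷ B) ≫ T.leg f g := by
  rw [← tensorHom_id, T.map_leg, J.map_id, Category.id_comp]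

theorem leg_map_right {X Y : 𝒟} {A B B' : 𝒞} (b : B ⟶ B') (f : J.obj A ⟶ X) (g : J.obj B' ⟶ Y) :
    T.leg f (J.map b ≫ g) = J.map (A ◁ b) ≫ T.leg f g := by
  rw [← id_tensorHom, T.map_leg, J.map_id, Category.id_comp]

/-! #### Universal properties -/

/-- The morphism out of `X ⊠ Y` given by a natural family. -/
def desc {X Y Z : 𝒟}
    (ψ : ∀ {A B : 𝒞}, (J.obj A ⟶ X) → (J.obj B ⟶ Y) → (J.obj (A ⊗ B) ⟶ Z))
    (h : ∀ {A B A' B' : 𝒞} (a : A ⟶ A') (b : B ⟶ B') (f : J.obj A' ⟶ X) (g : J.obj B' ⟶ Y),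
      J.map (a ⊗ₘ b) ≫ ψ f g = ψ (J.map a ≫ f) (J.map b ≫ g)) : T.obj X Y ⟶ Z :=
  (T.exists_desc ψ h).choose

theorem leg_desc {X Y Z : 𝒟}
    (ψ : ∀ {A B : 𝒞}, (J.obj A ⟶ X) → (J.obj B ⟶ Y) → (J.obj (A ⊗ B) ⟶ Z))
    (h : ∀ {A B A' B' : 𝒞} (a : A ⟶ A') (b : B ⟶ B') (f : J.obj A' ⟶ X) (g : J.obj B' ⟶ Y),
      J.map (a ⊗ₘ b) ≫ ψ f g = ψ (J.map a ≫ f) (J.map b ≫ g))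
    {A B : 𝒞} (f : J.obj A ⟶ X) (g : J.obj B ⟶ Y) : T.leg f g ≫ T.desc ψ h = ψ f g :=
  (T.exists_desc ψ h).choose_spec f g

/-- By compactness a map `J D ⟶ X ⊠ Y` factors through a leg, so nested legs generate all legs of
the iterated product. -/
theorem hom_ext_left {X Y W Z : 𝒟} {u v : T.obj (T.obj X Y) W ⟶ Z}
    (h : ∀ {A B E : 𝒞} (f : J.obj A ⟶ X) (g : J.obj B ⟶ Y) (k : J.obj E ⟶ W),
      T.leg (T.leg f g) k ≫ u = T.leg (T.leg f g) k ≫ v) : u = v := by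
  refine T.hom_ext fun f g => ?_
  obtain ⟨_, _, _, _, _, rfl⟩ := T.exists_factor f
  simp only [leg_map_left, Category.assoc, h]

theorem hom_ext_right {X Y W Z : 𝒟} {u v : T.obj X (T.obj Y W) ⟶ Z}
    (h : ∀ {A B E : 𝒞} (f : J.obj A ⟶ X) (g : J.obj B ⟶ Y) (k : J.obj E ⟶ W),
      T.leg f (T.leg g k) ≫ u = T.leg f (T.leg g k) ≫ v) : u = v := by
  refine T.hom_ext fun f g => ?_
  obtain ⟨_, _, _, _, _, rfl⟩ := T.exists_factor g
  simp only [leg_map_right, Category.assoc, h]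

theorem hom_ext_left_left {X Y W U Z : 𝒟} {u v : T.obj (T.obj (T.obj X Y) W) U ⟶ Z}
    (h : ∀ {A B E D : 𝒞} (f : J.obj A ⟶ X) (g : J.obj B ⟶ Y) (k : J.obj E ⟶ W) (l : J.obj D ⟶ U),
      T.leg (T.leg (T.leg f g) k) l ≫ u = T.leg (T.leg (T.leg f g) k) l ≫ v) : u = v := by
  refine T.hom_ext_left fun f g k => ?_
  obtain ⟨_, _, _, _, _, rfl⟩ := T.exists_factor f
  simp only [leg_map_left, Category.assoc, h]

/-- The existence half of Fubini. To define a map on the leg of `l : J D ⟶ X ⊠ Y` and `k`, factor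
`l` through a leg of `X ⊠ Y` and apply `ψ`. Any two factorizations agree after refinement, so
naturality of `ψ` makes the result independent of the choice. -/
theorem exists_desc_left {X Y W Z : 𝒟}
    (ψ : ∀ {A B E : 𝒞}, (J.obj A ⟶ X) → (J.obj B ⟶ Y) → (J.obj E ⟶ W) →
      (J.obj ((A ⊗ B) ⊗ E) ⟶ Z))
    (h : ∀ {A B E A' B' E' : 𝒞} (a : A ⟶ A') (b : B ⟶ B') (e : E ⟶ E')
      (f : J.obj A' ⟶ X) (g : J.obj B' ⟶ Y) (k : J.obj E' ⟶ W),
      J.map ((a ⊗ₘ b) ⊗ₘ e) ≫ ψ f g k = ψ (J.map a ≫ f) (J.map b ≫ g) (J.map e ≫ k)) :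
    ∃ u : T.obj (T.obj X Y) W ⟶ Z, ∀ {A B E : 𝒞} (f : J.obj A ⟶ X) (g : J.obj B ⟶ Y)
      (k : J.obj E ⟶ W), T.leg (T.leg f g) k ≫ u = ψ f g k := by
  -- Independence of the factorization, from `exists_refine` and naturality.
  have key : ∀ {D E A B A' B' : 𝒞} (f : J.obj A ⟶ X) (g : J.obj B ⟶ Y) (f' : J.obj A' ⟶ X)
      (g' : J.obj B' ⟶ Y) (d : D ⟶ A ⊗ B) (d' : D ⟶ A' ⊗ B') (k : J.obj E ⟶ W),
      J.map d ≫ T.leg f g = J.map d' ≫ T.leg f' g' →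
      J.map (d ▷ E) ≫ ψ f g k = J.map (d' ▷ E) ≫ ψ f' g' k := by
    intro D E A B A' B' f g f' g' d d' k H
    obtain ⟨A'', B'', f'', g'', a, b, a', b', rfl, rfl, rfl, rfl, e⟩ :=
      T.exists_refine f g f' g' d d' H
    have h₁ := h a b (𝟙 E) f'' g'' k
    have h₂ := h a' b' (𝟙 E) f'' g'' k
    rw [J.map_id, Category.id_comp, tensorHom_id] at h₁ h₂
    rw [← h₁, ← h₂, ← Category.assoc, ← Category.assoc, ← J.map_comp, ← J.map_comp,
      ← comp_whiskerRight, ← comp_whiskerRight, e]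
  choose A B f g d hd using fun {D : 𝒞} (k : J.obj D ⟶ T.obj X Y) => T.exists_factor k
  let Ψ : ∀ {D E : 𝒞}, (J.obj D ⟶ T.obj X Y) → (J.obj E ⟶ W) → (J.obj (D ⊗ E) ⟶ Z) :=
    fun {_ E} l k => J.map (d l ▷ E) ≫ ψ (f l) (g l) k
  have hΨ : ∀ {D E A B : 𝒞} (f : J.obj A ⟶ X) (g : J.obj B ⟶ Y) (d : D ⟶ A ⊗ B)
      (k : J.obj E ⟶ W), Ψ (J.map d ≫ T.leg f g) k = J.map (d ▷ E) ≫ ψ f g k :=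
    fun f g d k => key _ _ _ _ _ _ _ (hd _).symm
  -- For naturality, factor the target map `l` and precompose with `a`; by `hΨ` this factorization
  -- may be used for `J.map a ≫ l`.
  obtain ⟨u, hu⟩ := T.exists_desc Ψ (by
    intro D E D' E' a b l k
    obtain ⟨A, B, f, g, d, rfl⟩ := T.exists_factor l
    have h₁ := h (𝟙 A) (𝟙 B) b f g k
    rw [J.map_id, J.map_id, Category.id_comp, Category.id_comp, id_tensorHom_id,
      id_tensorHom] at h₁
    rw [hΨ, ← Category.assoc (J.map a), ← J.map_comp, hΨ, ← h₁, ← Category.assoc, ← Category.assoc,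
      ← J.map_comp, ← J.map_comp, MonoidalCategory.tensorHom_def, Category.assoc, whisker_exchange,
      comp_whiskerRight, Category.assoc])
  refine ⟨u, fun f g k => ?_⟩
  rw [hu]
  -- A leg factors through itself by the identity.
  have := hΨ f g (𝟙 _) k
  rwa [J.map_id, Category.id_comp, id_whiskerRight, J.map_id, Category.id_comp] at this

theorem exists_desc_right {X Y W Z : 𝒟}
    (ψ : ∀ {A B E : 𝒞}, (J.obj A ⟶ X) → (J.obj B ⟶ Y) → (J.obj E ⟶ W) →
      (J.obj (A ⊗ (B ⊗ E)) ⟶ Z))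
    (h : ∀ {A B E A' B' E' : 𝒞} (a : A ⟶ A') (b : B ⟶ B') (e : E ⟶ E')
      (f : J.obj A' ⟶ X) (g : J.obj B' ⟶ Y) (k : J.obj E' ⟶ W),
      J.map (a ⊗ₘ (b ⊗ₘ e)) ≫ ψ f g k = ψ (J.map a ≫ f) (J.map b ≫ g) (J.map e ≫ k)) :
    ∃ u : T.obj X (T.obj Y W) ⟶ Z, ∀ {A B E : 𝒞} (f : J.obj A ⟶ X) (g : J.obj B ⟶ Y)
      (k : J.obj E ⟶ W), T.leg f (T.leg g k) ≫ u = ψ f g k := by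
  have key : ∀ {D A B E B' E' : 𝒞} (g : J.obj B ⟶ Y) (k : J.obj E ⟶ W) (g' : J.obj B' ⟶ Y)
      (k' : J.obj E' ⟶ W) (d : D ⟶ B ⊗ E) (d' : D ⟶ B' ⊗ E') (f : J.obj A ⟶ X),
      J.map d ≫ T.leg g k = J.map d' ≫ T.leg g' k' →
      J.map (A ◁ d) ≫ ψ f g k = J.map (A ◁ d') ≫ ψ f g' k' := by
    intro D A B E B' E' g k g' k' d d' f H
    obtain ⟨B'', E'', g'', k'', b, e, b', e', rfl, rfl, rfl, rfl, he⟩ :=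
      T.exists_refine g k g' k' d d' H
    have h₁ := h (𝟙 A) b e f g'' k''
    have h₂ := h (𝟙 A) b' e' f g'' k''
    rw [J.map_id, Category.id_comp, id_tensorHom] at h₁ h₂
    rw [← h₁, ← h₂, ← Category.assoc, ← Category.assoc, ← J.map_comp, ← J.map_comp,
      ← whiskerLeft_comp, ← whiskerLeft_comp, he]
  choose A B f g d hd using fun {D : 𝒞} (k : J.obj D ⟶ T.obj Y W) => T.exists_factor k
  let Ψ : ∀ {E D : 𝒞}, (J.obj E ⟶ X) → (J.obj D ⟶ T.obj Y W) → (J.obj (E ⊗ D) ⟶ Z) :=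
    fun {E _} k l => J.map (E ◁ d l) ≫ ψ k (f l) (g l)
  have hΨ : ∀ {E D A B : 𝒞} (f : J.obj A ⟶ Y) (g : J.obj B ⟶ W) (d : D ⟶ A ⊗ B)
      (k : J.obj E ⟶ X), Ψ k (J.map d ≫ T.leg f g) = J.map (E ◁ d) ≫ ψ k f g :=
    fun f g d k => key _ _ _ _ _ _ _ (hd _).symm
  obtain ⟨u, hu⟩ := T.exists_desc Ψ (by
    intro E D E' D' b a k l
    obtain ⟨A, B, f, g, d, rfl⟩ := T.exists_factor l
    have h₁ := h b (𝟙 A) (𝟙 B) k f g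
    rw [J.map_id, J.map_id, Category.id_comp, Category.id_comp, id_tensorHom_id,
      tensorHom_id] at h₁
    rw [hΨ, ← Category.assoc (J.map a), ← J.map_comp, hΨ, ← h₁, ← Category.assoc, ← Category.assoc,
      ← J.map_comp, ← J.map_comp, MonoidalCategory.tensorHom_def, Category.assoc, whisker_exchange,
      whiskerLeft_comp])
  refine ⟨u, fun f g k => ?_⟩
  rw [hu]
  have := hΨ g k (𝟙 _) f
  rwa [J.map_id, Category.id_comp, whiskerLeft_id, J.map_id, Category.id_comp] at this

/-! #### The monoidal structure -/

theorem map_leg_comp {X X' Y Y' : 𝒟} (u : X ⟶ X') (v : Y ⟶ Y') {A B A' B' : 𝒞} (a : A ⟶ A')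
    (b : B ⟶ B') (f : J.obj A' ⟶ X) (g : J.obj B' ⟶ Y) :
    J.map (a ⊗ₘ b) ≫ T.leg (f ≫ u) (g ≫ v) =
      T.leg ((J.map a ≫ f) ≫ u) ((J.map b ≫ g) ≫ v) := by
  rw [T.map_leg, Category.assoc, Category.assoc]

/-- The tensor product of morphisms. -/
def map {X X' Y Y' : 𝒟} (u : X ⟶ X') (v : Y ⟶ Y') : T.obj X Y ⟶ T.obj X' Y' :=
  T.desc (fun f g => T.leg (f ≫ u) (g ≫ v)) (T.map_leg_comp u v)

theorem leg_map {X X' Y Y' : 𝒟} (u : X ⟶ X') (v : Y ⟶ Y') {A B : 𝒞} (f : J.obj A ⟶ X)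
    (g : J.obj B ⟶ Y) : T.leg f g ≫ T.map u v = T.leg (f ≫ u) (g ≫ v) := by
  rw [map, T.leg_desc _ (T.map_leg_comp u v)]

theorem leg_map_assoc {X X' Y Y' : 𝒟} (u : X ⟶ X') (v : Y ⟶ Y') {A B : 𝒞} (f : J.obj A ⟶ X)
    (g : J.obj B ⟶ Y)
    {W : 𝒟} (k : T.obj X' Y' ⟶ W) :
    T.leg f g ≫ T.map u v ≫ k = T.leg (f ≫ u) (g ≫ v) ≫ k := by
  rw [← Category.assoc, leg_map]

theorem exists_assocHom (X Y Z : 𝒟) : ∃ u : T.obj (T.obj X Y) Z ⟶ T.obj X (T.obj Y Z),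
    ∀ {A B E : 𝒞} (f : J.obj A ⟶ X) (g : J.obj B ⟶ Y) (k : J.obj E ⟶ Z),
      T.leg (T.leg f g) k ≫ u = J.map (α_ A B E).hom ≫ T.leg f (T.leg g k) :=
  T.exists_desc_left (fun {A B E} f g k => J.map (α_ A B E).hom ≫ T.leg f (T.leg g k))
    fun a b e f g k => by
      rw [← J.map_comp_assoc, associator_naturality, J.map_comp_assoc, T.map_leg, T.map_leg]

theorem exists_assocInv (X Y Z : 𝒟) : ∃ u : T.obj X (T.obj Y Z) ⟶ T.obj (T.obj X Y) Z,
    ∀ {A B E : 𝒞} (f : J.obj A ⟶ X) (g : J.obj B ⟶ Y) (k : J.obj E ⟶ Z),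
      T.leg f (T.leg g k) ≫ u = J.map (α_ A B E).inv ≫ T.leg (T.leg f g) k :=
  T.exists_desc_right (fun {A B E} f g k => J.map (α_ A B E).inv ≫ T.leg (T.leg f g) k)
    fun a b e f g k => by
      rw [← J.map_comp_assoc, associator_inv_naturality, J.map_comp_assoc, T.map_leg, T.map_leg]

theorem leg_assocHom (X Y Z : 𝒟) {A B E : 𝒞} (f : J.obj A ⟶ X) (g : J.obj B ⟶ Y)
    (k : J.obj E ⟶ Z) : T.leg (T.leg f g) k ≫ (T.exists_assocHom X Y Z).choose =
      J.map (α_ A B E).hom ≫ T.leg f (T.leg g k) :=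
  (T.exists_assocHom X Y Z).choose_spec f g k

theorem leg_assocInv (X Y Z : 𝒟) {A B E : 𝒞} (f : J.obj A ⟶ X) (g : J.obj B ⟶ Y)
    (k : J.obj E ⟶ Z) : T.leg f (T.leg g k) ≫ (T.exists_assocInv X Y Z).choose =
      J.map (α_ A B E).inv ≫ T.leg (T.leg f g) k :=
  (T.exists_assocInv X Y Z).choose_spec f g k

/-- The associator. -/
def assoc (X Y Z : 𝒟) : T.obj (T.obj X Y) Z ≅ T.obj X (T.obj Y Z) where
  hom := (T.exists_assocHom X Y Z).choose
  inv := (T.exists_assocInv X Y Z).choose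
  hom_inv_id := T.hom_ext_left fun f g k => by
    rw [← Category.assoc, leg_assocHom, Category.assoc, leg_assocInv, ← J.map_comp_assoc,
      Iso.hom_inv_id, J.map_id, Category.id_comp, Category.comp_id]
  inv_hom_id := T.hom_ext_right fun f g k => by
    rw [← Category.assoc, leg_assocInv, Category.assoc, leg_assocHom, ← J.map_comp_assoc,
      Iso.inv_hom_id, J.map_id, Category.id_comp, Category.comp_id]

theorem leg_assoc_hom {X Y Z : 𝒟} {A B E : 𝒞} (f : J.obj A ⟶ X) (g : J.obj B ⟶ Y)
    (k : J.obj E ⟶ Z) : T.leg (T.leg f g) k ≫ (T.assoc X Y Z).hom =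
      J.map (α_ A B E).hom ≫ T.leg f (T.leg g k) := T.leg_assocHom X Y Z f g k

theorem leg_assoc_hom_assoc {X Y Z : 𝒟} {A B E : 𝒞} (f : J.obj A ⟶ X) (g : J.obj B ⟶ Y)
    (k : J.obj E ⟶ Z)
    {W : 𝒟} (l : T.obj X (T.obj Y Z) ⟶ W) :
    T.leg (T.leg f g) k ≫ (T.assoc X Y Z).hom ≫ l =
      J.map (α_ A B E).hom ≫ T.leg f (T.leg g k) ≫ l := by
  rw [← Category.assoc, leg_assoc_hom, Category.assoc]

theorem leg_assoc_inv {X Y Z : 𝒟} {A B E : 𝒞} (f : J.obj A ⟶ X) (g : J.obj B ⟶ Y)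
    (k : J.obj E ⟶ Z) : T.leg f (T.leg g k) ≫ (T.assoc X Y Z).inv =
      J.map (α_ A B E).inv ≫ T.leg (T.leg f g) k := T.leg_assocInv X Y Z f g k

theorem leg_assoc_inv_assoc {X Y Z : 𝒟} {A B E : 𝒞} (f : J.obj A ⟶ X) (g : J.obj B ⟶ Y)
    (k : J.obj E ⟶ Z)
    {W : 𝒟} (l : T.obj (T.obj X Y) Z ⟶ W) :
    T.leg f (T.leg g k) ≫ (T.assoc X Y Z).inv ≫ l =
      J.map (α_ A B E).inv ≫ T.leg (T.leg f g) k ≫ l := by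
  rw [← Category.assoc, leg_assoc_inv, Category.assoc]

/-- The inverse unitors start from `X` itself, so they are built from density of `𝒞` rather than
from the universal property of the tensor product. -/
theorem exists_leftUnitorInv (X : 𝒟) : ∃ u : X ⟶ T.obj T.unit X,
    ∀ {A : 𝒞} (f : J.obj A ⟶ X), f ≫ u = J.map (λ_ A).inv ≫ T.leg T.unitIso.hom f :=
  T.exists_desc_obj (fun {A} f => J.map (λ_ A).inv ≫ T.leg T.unitIso.hom f) fun a f => by
    rw [leg_map_right, ← J.map_comp_assoc, ← J.map_comp_assoc, leftUnitor_inv_naturality]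

theorem exists_rightUnitorInv (X : 𝒟) : ∃ u : X ⟶ T.obj X T.unit,
    ∀ {A : 𝒞} (f : J.obj A ⟶ X), f ≫ u = J.map (ρ_ A).inv ≫ T.leg f T.unitIso.hom :=
  T.exists_desc_obj (fun {A} f => J.map (ρ_ A).inv ≫ T.leg f T.unitIso.hom) fun a f => by
    rw [leg_map_left, ← J.map_comp_assoc, ← J.map_comp_assoc, rightUnitor_inv_naturality]

theorem map_id (X Y : 𝒟) : T.map (𝟙 X) (𝟙 Y) = 𝟙 (T.obj X Y) :=
  T.hom_ext fun f g => by rw [leg_map, Category.comp_id, Category.comp_id, Category.comp_id]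

theorem map_comp {X₁ X₂ X₃ Y₁ Y₂ Y₃ : 𝒟} (f₁ : X₁ ⟶ X₂) (g₁ : Y₁ ⟶ Y₂) (f₂ : X₂ ⟶ X₃)
    (g₂ : Y₂ ⟶ Y₃) : T.map f₁ g₁ ≫ T.map f₂ g₂ = T.map (f₁ ≫ f₂) (g₁ ≫ g₂) :=
  T.hom_ext fun f g => by rw [leg_map_assoc, leg_map, leg_map, Category.assoc, Category.assoc]

theorem assoc_naturality {X₁ X₂ X₃ Y₁ Y₂ Y₃ : 𝒟} (f₁ : X₁ ⟶ Y₁) (f₂ : X₂ ⟶ Y₂) (f₃ : X₃ ⟶ Y₃) :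
    T.map (T.map f₁ f₂) f₃ ≫ (T.assoc Y₁ Y₂ Y₃).hom =
      (T.assoc X₁ X₂ X₃).hom ≫ T.map f₁ (T.map f₂ f₃) :=
  T.hom_ext_left fun f g k => by
    rw [leg_map_assoc, leg_map, leg_assoc_hom, leg_assoc_hom_assoc, leg_map, leg_map]

/-- On fourfold nested legs both sides are the images under `J` of the two sides of the pentagon of
`𝒞`, followed by the same leg. -/
theorem pentagon (W X Y Z : 𝒟) :
    T.map (T.assoc W X Y).hom (𝟙 Z) ≫ (T.assoc W (T.obj X Y) Z).hom ≫
        T.map (𝟙 W) (T.assoc X Y Z).hom =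
      (T.assoc (T.obj W X) Y Z).hom ≫ (T.assoc W X (T.obj Y Z)).hom :=
  T.hom_ext_left_left fun f g k l => by
    simp only [leg_map_assoc, leg_map, leg_assoc_hom, leg_assoc_hom_assoc, leg_map_left,
      leg_map_right, Category.assoc, Category.comp_id, ← J.map_comp_assoc,
      MonoidalCategory.pentagon]

/-! ### Unitors and the monoidal category -/

section Unit

variable [J.Full]

/-- Fullness makes the unit of `𝒞` weakly terminal among the objects of `𝒞` over `T.unit`. Legs with
a unit factor therefore need testing only at `T.unitIso.hom`. -/
theorem exists_map_unitIso {A : 𝒞} (u : J.obj A ⟶ T.unit) :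
    ∃ a : A ⟶ 𝟙_ 𝒞, u = J.map a ≫ T.unitIso.hom :=
  ⟨J.preimage (u ≫ T.unitIso.inv), by simp⟩

theorem hom_ext_unit_left {X Z : 𝒟} {u v : T.obj T.unit X ⟶ Z}
    (h : ∀ {A : 𝒞} (f : J.obj A ⟶ X),
      T.leg T.unitIso.hom f ≫ u = T.leg T.unitIso.hom f ≫ v) : u = v :=
  T.hom_ext fun f g => by
    obtain ⟨a, rfl⟩ := T.exists_map_unitIso f
    simp only [leg_map_left, Category.assoc, h]

theorem hom_ext_unit_right {X Z : 𝒟} {u v : T.obj X T.unit ⟶ Z}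
    (h : ∀ {A : 𝒞} (f : J.obj A ⟶ X),
      T.leg f T.unitIso.hom ≫ u = T.leg f T.unitIso.hom ≫ v) : u = v :=
  T.hom_ext fun f g => by
    obtain ⟨a, rfl⟩ := T.exists_map_unitIso g
    simp only [leg_map_right, Category.assoc, h]

variable [J.Faithful]

theorem preimage_map_comp {A B : 𝒞} (a : A ⟶ B) (u : J.obj B ⟶ T.unit) :
    J.preimage ((J.map a ≫ u) ≫ T.unitIso.inv) = a ≫ J.preimage (u ≫ T.unitIso.inv) :=
  J.map_injective (by simp)

theorem map_leftUnitor_comp {X : 𝒟} {A B A' B' : 𝒞} (a : A ⟶ A') (b : B ⟶ B')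
    (u : J.obj A' ⟶ T.unit) (f : J.obj B' ⟶ X) :
    J.map (a ⊗ₘ b) ≫ J.map (J.preimage (u ≫ T.unitIso.inv) ▷ B' ≫ (λ_ B').hom) ≫ f =
      J.map (J.preimage ((J.map a ≫ u) ≫ T.unitIso.inv) ▷ B ≫ (λ_ B).hom) ≫ J.map b ≫ f := by
  rw [preimage_map_comp, ← J.map_comp_assoc, ← J.map_comp_assoc,
    MonoidalCategory.tensorHom_def', Category.assoc, ← comp_whiskerRight_assoc,
    whisker_exchange_assoc, MonoidalCategory.leftUnitor_naturality, Category.assoc]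

theorem map_rightUnitor_comp {X : 𝒟} {A B A' B' : 𝒞} (a : A ⟶ A') (b : B ⟶ B')
    (f : J.obj A' ⟶ X) (u : J.obj B' ⟶ T.unit) :
    J.map (a ⊗ₘ b) ≫ J.map (A' ◁ J.preimage (u ≫ T.unitIso.inv) ≫ (ρ_ A').hom) ≫ f =
      J.map (A ◁ J.preimage ((J.map b ≫ u) ≫ T.unitIso.inv) ≫ (ρ_ A).hom) ≫ J.map a ≫ f := by
  rw [preimage_map_comp, ← J.map_comp_assoc, ← J.map_comp_assoc,
    MonoidalCategory.tensorHom_def, Category.assoc, ← whiskerLeft_comp_assoc,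
    ← whisker_exchange_assoc, MonoidalCategory.rightUnitor_naturality, Category.assoc]

/-- The underlying morphism of the left unitor. -/
def leftUnitorHom (X : 𝒟) : T.obj T.unit X ⟶ X :=
  T.desc (fun {_ B} u f => J.map (J.preimage (u ≫ T.unitIso.inv) ▷ B ≫ (λ_ B).hom) ≫ f)
    T.map_leftUnitor_comp

/-- The underlying morphism of the right unitor. -/
def rightUnitorHom (X : 𝒟) : T.obj X T.unit ⟶ X :=
  T.desc (fun {A _} f u => J.map (A ◁ J.preimage (u ≫ T.unitIso.inv) ≫ (ρ_ A).hom) ≫ f)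
    T.map_rightUnitor_comp

/-- Stated for arbitrary `u`, because the required formula for the unitor concerns all
`C`-submodules of `V`; the coherence proofs use only the case `u = T.unitIso.hom`. -/
theorem leg_leftUnitorHom {X : 𝒟} {A B : 𝒞} (u : J.obj A ⟶ T.unit) (f : J.obj B ⟶ X) :
    T.leg u f ≫ T.leftUnitorHom X =
      J.map (J.preimage (u ≫ T.unitIso.inv) ▷ B ≫ (λ_ B).hom) ≫ f := by
  rw [leftUnitorHom, T.leg_desc _ T.map_leftUnitor_comp]

theorem leg_rightUnitorHom {X : 𝒟} {A B : 𝒞} (f : J.obj A ⟶ X) (u : J.obj B ⟶ T.unit) :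
    T.leg f u ≫ T.rightUnitorHom X =
      J.map (A ◁ J.preimage (u ≫ T.unitIso.inv) ≫ (ρ_ A).hom) ≫ f := by
  rw [rightUnitorHom, T.leg_desc _ T.map_rightUnitor_comp]

theorem leg_unitIso_leftUnitorHom {X : 𝒟} {B : 𝒞} (f : J.obj B ⟶ X) :
    T.leg T.unitIso.hom f ≫ T.leftUnitorHom X = J.map (λ_ B).hom ≫ f := by
  have : J.preimage (T.unitIso.hom ≫ T.unitIso.inv) = 𝟙 (𝟙_ 𝒞) := J.map_injective (by simp)
  rw [leg_leftUnitorHom, this, id_whiskerRight, Category.id_comp]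

theorem leg_unitIso_rightUnitorHom {X : 𝒟} {B : 𝒞} (f : J.obj B ⟶ X) :
    T.leg f T.unitIso.hom ≫ T.rightUnitorHom X = J.map (ρ_ B).hom ≫ f := by
  have : J.preimage (T.unitIso.hom ≫ T.unitIso.inv) = 𝟙 (𝟙_ 𝒞) := J.map_injective (by simp)
  rw [leg_rightUnitorHom, this, whiskerLeft_id, Category.id_comp]

/-- The left unitor. -/
def leftUnitor (X : 𝒟) : T.obj T.unit X ≅ X where
  hom := T.leftUnitorHom X
  inv := (T.exists_leftUnitorInv X).choose
  hom_inv_id := T.hom_ext_unit_left fun f => by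
    rw [← Category.assoc, leg_unitIso_leftUnitorHom, Category.assoc,
      (T.exists_leftUnitorInv X).choose_spec, ← J.map_comp_assoc, Iso.hom_inv_id, J.map_id,
      Category.id_comp, Category.comp_id]
  inv_hom_id := T.hom_ext_obj fun f => by
    rw [← Category.assoc, (T.exists_leftUnitorInv X).choose_spec, Category.assoc,
      leg_unitIso_leftUnitorHom, ← J.map_comp_assoc, Iso.inv_hom_id, J.map_id,
      Category.id_comp, Category.comp_id]

/-- The right unitor. -/
def rightUnitor (X : 𝒟) : T.obj X T.unit ≅ X where
  hom := T.rightUnitorHom X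
  inv := (T.exists_rightUnitorInv X).choose
  hom_inv_id := T.hom_ext_unit_right fun f => by
    rw [← Category.assoc, leg_unitIso_rightUnitorHom, Category.assoc,
      (T.exists_rightUnitorInv X).choose_spec, ← J.map_comp_assoc, Iso.hom_inv_id, J.map_id,
      Category.id_comp, Category.comp_id]
  inv_hom_id := T.hom_ext_obj fun f => by
    rw [← Category.assoc, (T.exists_rightUnitorInv X).choose_spec, Category.assoc,
      leg_unitIso_rightUnitorHom, ← J.map_comp_assoc, Iso.inv_hom_id, J.map_id,
      Category.id_comp, Category.comp_id]

theorem leg_leftUnitor {X : 𝒟} {B : 𝒞} (f : J.obj B ⟶ X) :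
    T.leg T.unitIso.hom f ≫ (T.leftUnitor X).hom = J.map (λ_ B).hom ≫ f :=
  T.leg_unitIso_leftUnitorHom f

theorem leg_leftUnitor_assoc {X : 𝒟} {B : 𝒞} (f : J.obj B ⟶ X)
    {W : 𝒟} (k : X ⟶ W) :
    T.leg T.unitIso.hom f ≫ (T.leftUnitor X).hom ≫ k = J.map (λ_ B).hom ≫ f ≫ k := by
  rw [← Category.assoc, leg_leftUnitor, Category.assoc]

theorem leg_rightUnitor {X : 𝒟} {B : 𝒞} (f : J.obj B ⟶ X) :
    T.leg f T.unitIso.hom ≫ (T.rightUnitor X).hom = J.map (ρ_ B).hom ≫ f :=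
  T.leg_unitIso_rightUnitorHom f

theorem leg_rightUnitor_assoc {X : 𝒟} {B : 𝒞} (f : J.obj B ⟶ X)
    {W : 𝒟} (k : X ⟶ W) :
    T.leg f T.unitIso.hom ≫ (T.rightUnitor X).hom ≫ k = J.map (ρ_ B).hom ≫ f ≫ k := by
  rw [← Category.assoc, leg_rightUnitor, Category.assoc]

theorem leftUnitor_naturality {X Y : 𝒟} (f : X ⟶ Y) :
    T.map (𝟙 T.unit) f ≫ (T.leftUnitor Y).hom = (T.leftUnitor X).hom ≫ f :=
  T.hom_ext_unit_left fun g => by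
    rw [leg_map_assoc, Category.comp_id, leg_leftUnitor, leg_leftUnitor_assoc]

theorem rightUnitor_naturality {X Y : 𝒟} (f : X ⟶ Y) :
    T.map f (𝟙 T.unit) ≫ (T.rightUnitor Y).hom = (T.rightUnitor X).hom ≫ f :=
  T.hom_ext_unit_right fun g => by
    rw [leg_map_assoc, Category.comp_id, leg_rightUnitor, leg_rightUnitor_assoc]

theorem triangle (X Y : 𝒟) :
    (T.assoc X T.unit Y).hom ≫ T.map (𝟙 X) (T.leftUnitor Y).hom =
      T.map (T.rightUnitor X).hom (𝟙 Y) :=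
  T.hom_ext_left fun f g k => by
    -- Reduces the middle factor to the unit of `𝒞`, where the triangle axiom of `𝒞` applies.
    obtain ⟨a, rfl⟩ := T.exists_map_unitIso g
    rw [leg_map_right, leg_map_left]
    simp only [Category.assoc]
    rw [leg_assoc_hom_assoc, leg_map, leg_map, leg_leftUnitor, leg_rightUnitor, Category.comp_id,
      Category.comp_id, leg_map_left, leg_map_right, ← J.map_comp_assoc _ _ (T.leg f k),
      MonoidalCategory.triangle]

/-- The extended tensor product, unit object, associators and unitors. -/
@[reducible]
def monoidalCategoryStruct : MonoidalCategoryStruct 𝒟 where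
  tensorObj := T.obj
  whiskerLeft X _ _ f := T.map (𝟙 X) f
  whiskerRight f Y := T.map f (𝟙 Y)
  tensorHom := T.map
  tensorUnit := T.unit
  associator := T.assoc
  leftUnitor := T.leftUnitor
  rightUnitor := T.rightUnitor

/-- The extended monoidal structure. -/
@[reducible]
def monoidalCategory : MonoidalCategory 𝒟 :=
  letI := T.monoidalCategoryStruct
  MonoidalCategory.ofTensorHom
    (id_tensorHom_id := T.map_id)
    (id_tensorHom := fun _ _ _ _ => rfl)
    (tensorHom_id := fun _ _ => rfl)
    (tensorHom_comp_tensorHom := T.map_comp)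
    (associator_naturality := T.assoc_naturality)
    (leftUnitor_naturality := T.leftUnitor_naturality)
    (rightUnitor_naturality := T.rightUnitor_naturality)
    (pentagon := T.pentagon)
    (triangle := T.triangle)

end Unit

end TensorExtension

namespace TensorExtension

variable {𝒞 : Type u₁} [Category.{v₁} 𝒞] [MonoidalCategory 𝒞]
  {𝒟 : Type u₂} [Category.{v₂} 𝒟] {J : 𝒞 ⥤ 𝒟} (T : TensorExtension J)

/-! #### The braiding -/

section Braiding

variable [BraidedCategory 𝒞]

theorem map_braiding_comp {X Y : 𝒟} {A B A' B' : 𝒞} (a : A ⟶ A') (b : B ⟶ B')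
    (f : J.obj A' ⟶ X) (g : J.obj B' ⟶ Y) :
    J.map (a ⊗ₘ b) ≫ J.map (β_ A' B').hom ≫ T.leg g f =
      J.map (β_ A B).hom ≫ T.leg (J.map b ≫ g) (J.map a ≫ f) := by
  rw [← J.map_comp_assoc, BraidedCategory.braiding_naturality, J.map_comp_assoc, T.map_leg]

/-- The underlying morphism of the braiding. -/
def braidHom (X Y : 𝒟) : T.obj X Y ⟶ T.obj Y X :=
  T.desc (fun {A B} f g => J.map (β_ A B).hom ≫ T.leg g f) T.map_braiding_comp

theorem leg_braidHom {X Y : 𝒟} {A B : 𝒞} (f : J.obj A ⟶ X) (g : J.obj B ⟶ Y) :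
    T.leg f g ≫ T.braidHom X Y = J.map (β_ A B).hom ≫ T.leg g f := by
  rw [braidHom, T.leg_desc _ T.map_braiding_comp]

theorem leg_braidHom_assoc {X Y : 𝒟} {A B : 𝒞} (f : J.obj A ⟶ X) (g : J.obj B ⟶ Y)
    {W : 𝒟} (k : T.obj Y X ⟶ W) :
    T.leg f g ≫ T.braidHom X Y ≫ k = J.map (β_ A B).hom ≫ T.leg g f ≫ k := by
  rw [← Category.assoc, leg_braidHom, Category.assoc]

theorem map_braiding_inv_comp {X Y : 𝒟} {A B A' B' : 𝒞} (a : A ⟶ A') (b : B ⟶ B')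
    (f : J.obj A' ⟶ X) (g : J.obj B' ⟶ Y) :
    J.map (a ⊗ₘ b) ≫ J.map (β_ B' A').inv ≫ T.leg g f =
      J.map (β_ B A).inv ≫ T.leg (J.map b ≫ g) (J.map a ≫ f) := by
  rw [← J.map_comp_assoc, BraidedCategory.braiding_inv_naturality, J.map_comp_assoc, T.map_leg]

/-- The underlying morphism of the inverse of the braiding. -/
def braidInv (X Y : 𝒟) : T.obj Y X ⟶ T.obj X Y :=
  T.desc (fun {A B} f g => J.map (β_ B A).inv ≫ T.leg g f) T.map_braiding_inv_comp

theorem leg_braidInv {X Y : 𝒟} {A B : 𝒞} (f : J.obj A ⟶ Y) (g : J.obj B ⟶ X) :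
    T.leg f g ≫ T.braidInv X Y = J.map (β_ B A).inv ≫ T.leg g f := by
  rw [braidInv, T.leg_desc _ T.map_braiding_inv_comp]

theorem leg_braidInv_assoc {X Y : 𝒟} {A B : 𝒞} (f : J.obj A ⟶ Y) (g : J.obj B ⟶ X)
    {W : 𝒟} (k : T.obj X Y ⟶ W) :
    T.leg f g ≫ T.braidInv X Y ≫ k = J.map (β_ B A).inv ≫ T.leg g f ≫ k := by
  rw [← Category.assoc, leg_braidInv, Category.assoc]

/-- The braiding. -/
def braid (X Y : 𝒟) : T.obj X Y ≅ T.obj Y X where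
  hom := T.braidHom X Y
  inv := T.braidInv X Y
  hom_inv_id := T.hom_ext fun f g => by
    rw [leg_braidHom_assoc, leg_braidInv, ← J.map_comp_assoc, Iso.hom_inv_id, J.map_id,
      Category.id_comp, Category.comp_id]
  inv_hom_id := T.hom_ext fun f g => by
    rw [leg_braidInv_assoc, leg_braidHom, ← J.map_comp_assoc, Iso.inv_hom_id, J.map_id,
      Category.id_comp, Category.comp_id]

theorem leg_braid_hom {X Y : 𝒟} {A B : 𝒞} (f : J.obj A ⟶ X) (g : J.obj B ⟶ Y) :
    T.leg f g ≫ (T.braid X Y).hom = J.map (β_ A B).hom ≫ T.leg g f := T.leg_braidHom f g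

theorem leg_braid_hom_assoc {X Y : 𝒟} {A B : 𝒞} (f : J.obj A ⟶ X) (g : J.obj B ⟶ Y)
    {W : 𝒟} (k : T.obj Y X ⟶ W) :
    T.leg f g ≫ (T.braid X Y).hom ≫ k = J.map (β_ A B).hom ≫ T.leg g f ≫ k := by
  rw [← Category.assoc, leg_braid_hom, Category.assoc]

theorem braid_naturality {X X' Y Y' : 𝒟} (u : X ⟶ X') (v : Y ⟶ Y') :
    T.map u v ≫ (T.braid X' Y').hom = (T.braid X Y).hom ≫ T.map v u :=
  T.hom_ext fun f g => by
    rw [leg_map_assoc, leg_braid_hom, leg_braid_hom_assoc, leg_map]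

theorem hexagon_forward (X Y Z : 𝒟) :
    (T.assoc X Y Z).hom ≫ (T.braid X (T.obj Y Z)).hom ≫ (T.assoc Y Z X).hom =
      T.map (T.braid X Y).hom (𝟙 Z) ≫ (T.assoc Y X Z).hom ≫ T.map (𝟙 Y) (T.braid X Z).hom :=
  T.hom_ext_left fun f g k => by
    simp only [leg_map_assoc, leg_map, leg_assoc_hom, leg_assoc_hom_assoc, leg_map_left,
      leg_map_right, leg_braid_hom, leg_braid_hom_assoc, Category.assoc, Category.comp_id,
      ← J.map_comp_assoc, BraidedCategory.hexagon_forward]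

theorem hexagon_reverse (X Y Z : 𝒟) :
    (T.assoc X Y Z).inv ≫ (T.braid (T.obj X Y) Z).hom ≫ (T.assoc Z X Y).inv =
      T.map (𝟙 X) (T.braid Y Z).hom ≫ (T.assoc X Z Y).inv ≫ T.map (T.braid X Z).hom (𝟙 Y) :=
  T.hom_ext_right fun f g k => by
    simp only [leg_map_assoc, leg_map, leg_assoc_inv, leg_assoc_inv_assoc, leg_map_left,
      leg_map_right, leg_braid_hom, leg_braid_hom_assoc, Category.assoc, Category.comp_id,
      ← J.map_comp_assoc, BraidedCategory.hexagon_reverse]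

/-- The extended braiding. -/
@[reducible]
def braidedCategory [J.Full] [J.Faithful] : @BraidedCategory 𝒟 _ T.monoidalCategory :=
  letI := T.monoidalCategory
  { braiding := T.braid
    braiding_naturality_right := fun X _ _ f => T.braid_naturality (𝟙 X) f
    braiding_naturality_left := fun f Z => T.braid_naturality f (𝟙 Z)
    hexagon_forward := T.hexagon_forward
    hexagon_reverse := T.hexagon_reverse }

end Braiding

/-! #### The twist -/

section Twist

include T in
-- Naturality of `θ` makes the maps `J.map (θ.app A) ≫ f` a compatible family on the objects over
-- `X`.
theorem exists_extend (θ : 𝟭 𝒞 ⟶ 𝟭 𝒞) (X : 𝒟) :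
    ∃ u : X ⟶ X, ∀ {A : 𝒞} (f : J.obj A ⟶ X), f ≫ u = J.map (θ.app A) ≫ f :=
  T.exists_desc_obj (fun {A} f => J.map (θ.app A) ≫ f) fun {A A'} a f => by
    have h : a ≫ θ.app A' = θ.app A ≫ a := θ.naturality a
    rw [← J.map_comp_assoc, ← J.map_comp_assoc, h]

/-- The extension of an endomorphism of the identity functor. -/
def extend (θ : 𝟭 𝒞 ⟶ 𝟭 𝒞) (X : 𝒟) : X ⟶ X := (T.exists_extend θ X).choose

theorem comp_extend (θ : 𝟭 𝒞 ⟶ 𝟭 𝒞) {X : 𝒟} {A : 𝒞} (f : J.obj A ⟶ X) :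
    f ≫ T.extend θ X = J.map (θ.app A) ≫ f := (T.exists_extend θ X).choose_spec f

theorem comp_extend_assoc (θ : 𝟭 𝒞 ⟶ 𝟭 𝒞) {X : 𝒟} {A : 𝒞} (f : J.obj A ⟶ X)
    {W : 𝒟} (k : X ⟶ W) :
    f ≫ T.extend θ X ≫ k = J.map (θ.app A) ≫ f ≫ k := by
  rw [← Category.assoc, comp_extend, Category.assoc]

theorem extend_comp_extend (θ θ' : 𝟭 𝒞 ⟶ 𝟭 𝒞) (h : θ ≫ θ' = 𝟙 _) (X : 𝒟) :
    T.extend θ X ≫ T.extend θ' X = 𝟙 X :=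
  T.hom_ext_obj fun {A} f => by
    have hA : θ.app A ≫ θ'.app A = 𝟙 A := congrArg (fun η => NatTrans.app η A) h
    have hJ : J.map (θ.app A) ≫ J.map (θ'.app A) = 𝟙 (J.obj A) := by
      rw [← J.map_comp, ← J.map_id]
      exact congrArg J.map hA
    rw [comp_extend_assoc, comp_extend, Category.comp_id]
    exact (Category.assoc _ _ _).symm.trans ((congrArg (· ≫ f) hJ).trans (Category.id_comp f))

theorem extend_naturality (θ : 𝟭 𝒞 ⟶ 𝟭 𝒞) {X Y : 𝒟} (u : X ⟶ Y) :
    u ≫ T.extend θ Y = T.extend θ X ≫ u :=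
  T.hom_ext_obj fun f => by
    rw [comp_extend_assoc, ← Category.assoc, comp_extend]

/-- The extension of an automorphism of the identity functor. -/
def twist (θ : 𝟭 𝒞 ≅ 𝟭 𝒞) : 𝟭 𝒟 ≅ 𝟭 𝒟 :=
  NatIso.ofComponents
    (fun X =>
      { hom := T.extend θ.hom X
        inv := T.extend θ.inv X
        hom_inv_id := T.extend_comp_extend _ _ θ.hom_inv_id X
        inv_hom_id := T.extend_comp_extend _ _ θ.inv_hom_id X })
    (fun u => T.extend_naturality θ.hom u)

theorem comp_twist (θ : 𝟭 𝒞 ≅ 𝟭 𝒞) {X : 𝒟} {A : 𝒞} (f : J.obj A ⟶ X) :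
    f ≫ (T.twist θ).hom.app X = J.map (θ.hom.app A) ≫ f := T.comp_extend θ.hom f

theorem twist_unit [J.Full] (θ : 𝟭 𝒞 ≅ 𝟭 𝒞) (hθ : θ.hom.app (𝟙_ 𝒞) = 𝟙 (𝟙_ 𝒞)) :
    (T.twist θ).hom.app T.unit = 𝟙 T.unit :=
  T.hom_ext_obj fun f => by
    obtain ⟨a, rfl⟩ := T.exists_map_unitIso f
    have h := T.comp_twist θ T.unitIso.hom
    rw [hθ] at h
    have h' : T.unitIso.hom ≫ (T.twist θ).hom.app T.unit = T.unitIso.hom :=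
      (h.trans (congrArg (· ≫ T.unitIso.hom) (J.map_id _))).trans (Category.id_comp _)
    exact (Category.assoc _ _ _).trans ((congrArg (J.map a ≫ ·) h').trans
      (Category.comp_id _).symm)

theorem twist_balancing [BraidedCategory 𝒞] (θ : 𝟭 𝒞 ≅ 𝟭 𝒞)
    (hθ : ∀ A B : 𝒞, θ.hom.app (A ⊗ B) =
      (θ.hom.app A ⊗ₘ θ.hom.app B) ≫ (β_ A B).hom ≫ (β_ B A).hom) (X Y : 𝒟) :
    (T.twist θ).hom.app (T.obj X Y) =
      T.map ((T.twist θ).hom.app X) ((T.twist θ).hom.app Y) ≫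
        (T.braid X Y).hom ≫ (T.braid Y X).hom :=
  T.hom_ext fun f g => by
    have h : T.leg f g ≫ (T.braid X Y).hom ≫ (T.braid Y X).hom =
        J.map ((β_ _ _).hom ≫ (β_ _ _).hom) ≫ T.leg f g := by
      rw [leg_braid_hom_assoc, leg_braid_hom, J.map_comp_assoc]
    rw [leg_map_assoc, comp_twist, comp_twist, comp_twist, hθ, ← T.map_leg, Category.assoc]
    exact (J.map_comp_assoc _ _ _).trans (congrArg _ h.symm)

end Twist

/-! #### Linearity -/

section Linear

variable [Preadditive 𝒞] [Preadditive 𝒟] [J.Additive] [MonoidalPreadditive 𝒞]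
  (hJ : ∀ {X : 𝒟} {A : 𝒞} (f g : J.obj A ⟶ X), ∃ (B : 𝒞) (k : J.obj B ⟶ X) (a b : A ⟶ B),
    f = J.map a ≫ k ∧ g = J.map b ≫ k)

include hJ

/-- Legs at `f`, `f'` and `f + f'` are a priori unrelated. Writing both maps through one `k`, as
`hJ` permits, moves the sum into `𝒞`, where whiskering is additive. -/
theorem leg_add_left {X Y : 𝒟} {A B : 𝒞} (f f' : J.obj A ⟶ X) (g : J.obj B ⟶ Y) :
    T.leg (f + f') g = T.leg f g + T.leg f' g := by
  obtain ⟨E, k, a, b, rfl, rfl⟩ := hJ f f'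
  rw [← Preadditive.add_comp, ← J.map_add, leg_map_left, leg_map_left, leg_map_left,
    MonoidalPreadditive.add_whiskerRight, J.map_add, Preadditive.add_comp]

theorem leg_add_right {X Y : 𝒟} {A B : 𝒞} (f : J.obj A ⟶ X) (g g' : J.obj B ⟶ Y) :
    T.leg f (g + g') = T.leg f g + T.leg f g' := by
  obtain ⟨E, k, a, b, rfl, rfl⟩ := hJ g g'
  rw [← Preadditive.add_comp, ← J.map_add, leg_map_right, leg_map_right, leg_map_right,
    MonoidalPreadditive.whiskerLeft_add, J.map_add, Preadditive.add_comp]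

theorem map_add_left {X X' Y Y' : 𝒟} (u u' : X ⟶ X') (v : Y ⟶ Y') :
    T.map (u + u') v = T.map u v + T.map u' v :=
  T.hom_ext fun f g => by
    rw [Preadditive.comp_add, leg_map, leg_map, leg_map, Preadditive.comp_add,
      T.leg_add_left hJ]

theorem map_add_right {X X' Y Y' : 𝒟} (u : X ⟶ X') (v v' : Y ⟶ Y') :
    T.map u (v + v') = T.map u v + T.map u v' :=
  T.hom_ext fun f g => by
    rw [Preadditive.comp_add, leg_map, leg_map, leg_map, Preadditive.comp_add,
      T.leg_add_right hJ]

theorem monoidalPreadditive [J.Full] [J.Faithful] :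
    @MonoidalPreadditive 𝒟 _ _ T.monoidalCategory :=
  letI := T.monoidalCategory
  { whiskerLeft_zero := fun {X Y Z} =>
      -- Preservation of zero follows from additivity: the value at `0` equals twice itself.
      add_eq_left.1 ((T.map_add_right hJ (𝟙 X) (0 : Y ⟶ Z) 0).symm.trans (by rw [add_zero]))
    zero_whiskerRight := fun {X Y Z} =>
      add_eq_left.1 ((T.map_add_left hJ (0 : Y ⟶ Z) 0 (𝟙 X)).symm.trans (by rw [add_zero]))
    whiskerLeft_add := fun {X _ _} f g => T.map_add_right hJ (𝟙 X) f g
    add_whiskerRight := fun {X _ _} f g => T.map_add_left hJ f g (𝟙 X) }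

end Linear

section Smul

variable (R : Type*) [Semiring R] [Preadditive 𝒞] [Preadditive 𝒟] [Linear R 𝒞] [Linear R 𝒟]
  [J.Linear R] [MonoidalPreadditive 𝒞] [MonoidalLinear R 𝒞]

/-- A scalar acts through the endomorphism `r • 𝟙 A` of `𝒞`, so no common factorization is needed.
-/
theorem leg_smul_left (r : R) {X Y : 𝒟} {A B : 𝒞} (f : J.obj A ⟶ X) (g : J.obj B ⟶ Y) :
    T.leg (r • f) g = r • T.leg f g := by
  have h : r • f = J.map (r • 𝟙 A) ≫ f := by
    rw [J.map_smul, J.map_id, Linear.smul_comp, Category.id_comp]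
  rw [h, leg_map_left, MonoidalLinear.smul_whiskerRight, id_whiskerRight, J.map_smul, J.map_id,
    Linear.smul_comp, Category.id_comp]

theorem leg_smul_right (r : R) {X Y : 𝒟} {A B : 𝒞} (f : J.obj A ⟶ X) (g : J.obj B ⟶ Y) :
    T.leg f (r • g) = r • T.leg f g := by
  have h : r • g = J.map (r • 𝟙 B) ≫ g := by
    rw [J.map_smul, J.map_id, Linear.smul_comp, Category.id_comp]
  rw [h, leg_map_right, MonoidalLinear.whiskerLeft_smul, whiskerLeft_id, J.map_smul, J.map_id,
    Linear.smul_comp, Category.id_comp]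

theorem monoidalLinear [J.Full] [J.Faithful]
    (h : @MonoidalPreadditive 𝒟 _ _ T.monoidalCategory) :
    @MonoidalLinear R _ 𝒟 _ _ _ T.monoidalCategory h :=
  letI := T.monoidalCategory
  { whiskerLeft_smul := fun X Y Z r f => T.hom_ext fun k l => by
      refine (T.leg_map (𝟙 X) (r • f) k l).trans ?_
      rw [Linear.comp_smul, Linear.comp_smul, T.leg_smul_right R]
      exact congrArg (r • ·) (T.leg_map (𝟙 X) f k l).symm
    smul_whiskerRight := fun r Y Z f X => T.hom_ext fun k l => by
      refine (T.leg_map (r • f) (𝟙 X) k l).trans ?_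
      rw [Linear.comp_smul, Linear.comp_smul, T.leg_smul_left R]
      exact congrArg (r • ·) (T.leg_map f (𝟙 X) k l).symm }

end Smul

end TensorExtension

/-! ### The tensor product on the direct limit completion -/

section IndTensor

open WeakModule

variable {V : VertexOperatorAlgebra.{u}} {C : ObjectProperty (WeakModule V)} (hC : IsAdmissible C)

/-! #### Colimits in `Ind(C)` are colimits of weak modules -/

-- The union of all `C`-submodules of `Z` is the largest submodule of `Z` in `Ind(C)`; the images of
-- `C`-submodules of `X` show that every homomorphism from `X` lands in it.
include hC in
theorem exists_indPart (Z : WeakModule V) : ∃ S : Z.Sub, IndCompletion C S.toModule ∧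
    ∀ {X : WeakModule V} (f : X ⟶ Z), IndCompletion C X →
      LinearMap.range (toLin f) ≤ LinearMap.range (toLin S.incl) := by
  let S : Z.Sub :=
    { carrier := {z | ∃ W : CSub C Z, z ∈ W.1.toSubmodule}
      zero_mem' := by
        obtain ⟨W⟩ := CSub.nonempty hC Z
        exact ⟨W, W.1.zero_mem'⟩
      add_mem' := by
        rintro x y ⟨W, hW⟩ ⟨W', hW'⟩
        obtain ⟨R, h, h'⟩ := CSub.exists_ge_ge hC W W'
        exact ⟨R, R.1.add_mem' (h hW) (h' hW')⟩
      smul_mem' := by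
        rintro c x ⟨W, hW⟩
        exact ⟨W, W.1.smul_mem' c hW⟩
      mode_mem := by
        rintro n v x ⟨W, hW⟩
        exact ⟨W, W.1.mode_mem n v x hW⟩ }
  refine ⟨S, ?_, fun {X} f hX => ?_⟩
  · rw [indCompletion_iff hC]
    rintro ⟨x, W, hW⟩
    obtain ⟨S', h⟩ := CSub.exists_preimage hC S.incl S.incl_injective W
    exact ⟨S', h _ hW⟩
  · rw [indCompletion_iff hC] at hX
    rw [Sub.range_incl]
    rintro _ ⟨x, rfl⟩
    obtain ⟨W, hW⟩ := hX x
    exact ⟨W.map hC f, ⟨x, hW⟩, rfl⟩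

-- Homomorphisms from `X` and from the stages to any `Z` factor uniquely through the part of `Z`
-- given by `exists_indPart`. A universal property tested inside `Ind(C)` thus holds among all weak
-- modules.
include hC in
theorem isDirectLimit_of_ind {J : Type u} [Category.{u} J] {F : J ⥤ WeakModule V}
    (hF : ∀ j, C (F.obj j)) {X : WeakModule V} (hX : IndCompletion C X)
    (φ : ∀ j, F.obj j ⟶ X) (hφ : ∀ {i j : J} (f : i ⟶ j), F.map f ≫ φ j = φ i)
    (hdesc : ∀ Z : WeakModule V, IndCompletion C Z → ∀ ψ : ∀ j, F.obj j ⟶ Z,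
      (∀ {i j : J} (f : i ⟶ j), F.map f ≫ ψ j = ψ i) → ∃ u : X ⟶ Z, ∀ j, φ j ≫ u = ψ j)
    (hext : ∀ Z : WeakModule V, IndCompletion C Z → ∀ u v : X ⟶ Z,
      (∀ j, φ j ≫ u = φ j ≫ v) → u = v) : IsDirectLimit F X φ := by
  have hdesc' : ∀ (Z : WeakModule V) (ψ : ∀ j, F.obj j ⟶ Z),
      (∀ {i j : J} (f : i ⟶ j), F.map f ≫ ψ j = ψ i) → ∃ u : X ⟶ Z, ∀ j, φ j ≫ u = ψ j := by
    intro Z ψ hψ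
    obtain ⟨S, hS, hr⟩ := exists_indPart hC Z
    have hl := fun j => liftOfInjective_comp S.incl S.incl_injective (ψ j)
      (hr _ (hC.le_indCompletion _ (hF j)))
    obtain ⟨u, hu⟩ := hdesc S.toModule hS
      (fun j => liftOfInjective S.incl S.incl_injective (ψ j)
        (hr _ (hC.le_indCompletion _ (hF j))))
      fun f => by rw [← cancel_mono S.incl, Category.assoc, hl, hl, hψ]
    exact ⟨u ≫ S.incl, fun j => by rw [← Category.assoc, hu, hl]⟩
  have hext' : ∀ (Z : WeakModule V) (u v : X ⟶ Z), (∀ j, φ j ≫ u = φ j ≫ v) → u = v := by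
    intro Z u v h
    obtain ⟨S, hS, hr⟩ := exists_indPart hC Z
    have hu := liftOfInjective_comp S.incl S.incl_injective u (hr _ hX)
    have hv := liftOfInjective_comp S.incl S.incl_injective v (hr _ hX)
    rw [← hu, ← hv]
    congr 1
    refine hext _ hS _ _ fun j => ?_
    rw [← cancel_mono S.incl, Category.assoc, Category.assoc, hu, hv, h]
  refine ⟨{ app := φ, naturality := fun _ _ f => (hφ f).trans (Category.comp_id _).symm },
    fun _ => rfl, ⟨{
      desc := fun s => (hdesc' s.pt s.ι.app fun f => s.w f).choose
      fac := fun s => (hdesc' s.pt s.ι.app fun f => s.w f).choose_spec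
      uniq := fun s m hm => hext' _ _ _ fun j =>
        (hm j).trans ((hdesc' s.pt s.ι.app fun f => s.w f).choose_spec j).symm }⟩⟩

/-! #### Tensor products of objects of `Ind(C)` -/

/-- The inclusion of `C` in `Ind(C)`. -/
abbrev toInd : C.FullSubcategory ⥤ (IndCompletion C).FullSubcategory :=
  ObjectProperty.ιOfLE hC.le_indCompletion

instance : (toInd hC).Additive where
  map_add := rfl

instance : (toInd hC).Linear ℂ where
  map_smul _ _ := rfl

/-- The inclusion of a `C`-submodule as a morphism of `Ind(C)`. -/
abbrev CSub.inclInd {X : (IndCompletion C).FullSubcategory} (W : CSub C X.obj) :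
    (toInd hC).obj W.obj ⟶ X := ObjectProperty.homMk W.incl

/-- Reduces arbitrary maps into `C`-submodules to surjections onto images and inclusions, so that
compatibility with inclusions implies full naturality. -/
theorem CSub.exists_eq_toImage_comp_transition {X : WeakModule V} {A : C.FullSubcategory}
    (S : CSub C X) (a : A ⟶ S.obj) : ∃ h : CSub.image hC (a.hom ≫ S.incl) ≤ S,
      CSub.toImage hC (a.hom ≫ S.incl) ≫ CSub.transition h = a :=
  ⟨CSub.image_le hC _ S a rfl, rfl⟩

include hC in
theorem CSub.exists_ge_image {X : WeakModule V} {A A' : C.FullSubcategory} (f : A.obj ⟶ X)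
    (f' : A'.obj ⟶ X) : ∃ (S : CSub C X) (a : A ⟶ S.obj) (a' : A' ⟶ S.obj),
      a.hom ≫ S.incl = f ∧ a'.hom ≫ S.incl = f' := by
  obtain ⟨S, h, h'⟩ := CSub.exists_ge_ge hC (CSub.image hC f) (CSub.image hC f')
  exact ⟨S, CSub.toImage hC f ≫ CSub.transition h, CSub.toImage hC f' ≫ CSub.transition h',
    rfl, rfl⟩

/-- Pairs of `C`-submodules. -/
structure CSubPair (C : ObjectProperty (WeakModule V)) (X₁ X₂ : WeakModule V) : Type u where
  fst : CSub C X₁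
  snd : CSub C X₂

namespace CSubPair

variable {X₁ X₂ : WeakModule V}

/-- On a plain product type the category structure is the product category; direct limits are built
over categories coming from a preorder, hence the separate type of pairs. -/
instance : Preorder (CSubPair C X₁ X₂) := Preorder.lift fun W => (W.fst, W.snd)

include hC in
theorem nonempty (X₁ X₂ : WeakModule V) : Nonempty (CSubPair C X₁ X₂) :=
  let ⟨S⟩ := CSub.nonempty hC X₁
  let ⟨S'⟩ := CSub.nonempty hC X₂
  ⟨⟨S, S'⟩⟩

include hC in
theorem isDirectedOrder (X₁ X₂ : WeakModule V) : IsDirectedOrder (CSubPair C X₁ X₂) where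
  directed W W' :=
    let ⟨S, h, h'⟩ := CSub.exists_ge_ge hC W.fst W'.fst
    let ⟨S', k, k'⟩ := CSub.exists_ge_ge hC W.snd W'.snd
    ⟨⟨S, S'⟩, ⟨h, k⟩, ⟨h', k'⟩⟩

/-- The functor from the preorder of pairs to the product category. -/
def toProd (C : ObjectProperty (WeakModule V)) (X₁ X₂ : WeakModule V) :
    CSubPair C X₁ X₂ ⥤ CSub C X₁ × CSub C X₂ where
  obj W := (W.fst, W.snd)
  map h := (homOfLE (leOfHom h).1, homOfLE (leOfHom h).2)

end CSubPair

variable [MonoidalCategory C.FullSubcategory]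

/-- The system `(W₁, W₂) ↦ W₁ ⊠ W₂` as a directed system. -/
abbrev directedTensorSystem (C : ObjectProperty (WeakModule V)) [MonoidalCategory C.FullSubcategory]
    (X₁ X₂ : WeakModule V) : CSubPair C X₁ X₂ ⥤ WeakModule V :=
  CSubPair.toProd C X₁ X₂ ⋙ tensorSystem C X₁ X₂

/-- The direct limit of the system `(W₁, W₂) ↦ W₁ ⊠ W₂`. -/
def tensorCocone (X₁ X₂ : WeakModule V) : Cocone (tensorSystem C X₁ X₂) :=
  haveI := CSubPair.nonempty hC X₁ X₂
  haveI := CSubPair.isDirectedOrder hC X₁ X₂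
  { pt := directLimit (directedTensorSystem C X₁ X₂)
    ι :=
      { app := fun W => directLimitι (directedTensorSystem C X₁ X₂) ⟨W.1, W.2⟩
        naturality := fun _ _ h => (map_directLimitι (directedTensorSystem C X₁ X₂)
          (i := ⟨_, _⟩) (j := ⟨_, _⟩)
          (homOfLE ⟨leOfHom h.1, leOfHom h.2⟩)).trans (Category.comp_id _).symm } }

/-- The direct limit of the system `(W₁, W₂) ↦ W₁ ⊠ W₂` is a colimit of a directed system. -/
def directedTensorIsColimit (X₁ X₂ : WeakModule V) :
    IsColimit ((tensorCocone hC X₁ X₂).whisker (CSubPair.toProd C X₁ X₂)) :=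
  haveI := CSubPair.nonempty hC X₁ X₂
  haveI := CSubPair.isDirectedOrder hC X₁ X₂
  directLimitIsColimit (directedTensorSystem C X₁ X₂)

/-- The direct limit of the system `(W₁, W₂) ↦ W₁ ⊠ W₂` is a colimit. -/
def tensorIsColimit (X₁ X₂ : WeakModule V) : IsColimit (tensorCocone hC X₁ X₂) where
  desc s := (directedTensorIsColimit hC X₁ X₂).desc (s.whisker (CSubPair.toProd C X₁ X₂))
  fac s W := (directedTensorIsColimit hC X₁ X₂).fac (s.whisker (CSubPair.toProd C X₁ X₂))
    ⟨W.1, W.2⟩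
  uniq s m hm := (directedTensorIsColimit hC X₁ X₂).uniq (s.whisker (CSubPair.toProd C X₁ X₂)) m
    fun W => hm (W.fst, W.snd)

theorem indCompletion_tensorCocone (X₁ X₂ : WeakModule V) :
    IndCompletion C (tensorCocone hC X₁ X₂).pt :=
  haveI := CSubPair.nonempty hC X₁ X₂
  haveI := CSubPair.isDirectedOrder hC X₁ X₂
  indCompletion_directLimit hC (directedTensorSystem C X₁ X₂)
    fun W => (W.fst.obj ⊗ W.snd.obj).property

/-- The canonical homomorphism `W₁ ⊠ W₂ ⟶ X₁ ⊠̂ X₂`. -/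
def tensorι {X₁ X₂ : WeakModule V} (S : CSub C X₁) (S' : CSub C X₂) :
    (S.obj ⊗ S'.obj).obj ⟶ (tensorCocone hC X₁ X₂).pt :=
  (tensorCocone hC X₁ X₂).ι.app (S, S')

theorem transition_tensorι {X₁ X₂ : WeakModule V} {S R : CSub C X₁} {S' R' : CSub C X₂}
    (h : S ≤ R) (h' : S' ≤ R') :
    (CSub.transition h ⊗ₘ CSub.transition h').hom ≫ tensorι hC R R' = tensorι hC S S' :=
  (tensorCocone hC X₁ X₂).w (j := (R, R')) (j' := (S, S')) (homOfLE h, homOfLE h')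

/-- The canonical homomorphism `A ⊠ B ⟶ X₁ ⊠̂ X₂` given by `f : A ⟶ X₁` and `g : B ⟶ X₂`. -/
def tensorLeg {X₁ X₂ : WeakModule V} {A B : C.FullSubcategory} (f : A.obj ⟶ X₁) (g : B.obj ⟶ X₂) :
    (A ⊗ B).obj ⟶ (tensorCocone hC X₁ X₂).pt :=
  (CSub.toImage hC f ⊗ₘ CSub.toImage hC g).hom ≫
    tensorι hC (CSub.image hC f) (CSub.image hC g)

/-- The leg may be computed through any `C`-submodules containing the images, because inclusions are
compatible with the colimit maps. -/
theorem tensorLeg_eq {X₁ X₂ : WeakModule V} {A B : C.FullSubcategory} (S : CSub C X₁)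
    (S' : CSub C X₂) (a : A ⟶ S.obj) (b : B ⟶ S'.obj) :
    (a ⊗ₘ b).hom ≫ tensorι hC S S' =
      tensorLeg hC (a.hom ≫ S.incl) (b.hom ≫ S'.incl) := by
  obtain ⟨h, e⟩ := CSub.exists_eq_toImage_comp_transition hC S a
  obtain ⟨h', e'⟩ := CSub.exists_eq_toImage_comp_transition hC S' b
  rw [tensorLeg, ← transition_tensorι hC h h', ← Category.assoc, ← ObjectProperty.FullSubcategory.comp_hom, tensorHom_comp_tensorHom, e, e']

theorem tensorLeg_incl {X₁ X₂ : WeakModule V} (S : CSub C X₁) (S' : CSub C X₂) :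
    tensorLeg hC S.incl S'.incl = tensorι hC S S' := by
  have := tensorLeg_eq hC S S' (𝟙 _) (𝟙 _)
  rw [id_tensorHom_id] at this
  exact this.symm

theorem comp_tensorLeg {X₁ X₂ : WeakModule V} {A B A' B' : C.FullSubcategory} (a : A ⟶ A')
    (b : B ⟶ B') (f : A'.obj ⟶ X₁) (g : B'.obj ⟶ X₂) :
    (a ⊗ₘ b).hom ≫ tensorLeg hC f g = tensorLeg hC (a.hom ≫ f) (b.hom ≫ g) := by
  rw [tensorLeg, ← Category.assoc, ← ObjectProperty.FullSubcategory.comp_hom,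
    tensorHom_comp_tensorHom, tensorLeg_eq]
  rfl

theorem tensorLeg_exists_factor {X₁ X₂ : WeakModule V} {D : C.FullSubcategory}
    (k : D.obj ⟶ (tensorCocone hC X₁ X₂).pt) : ∃ (S : CSub C X₁) (S' : CSub C X₂)
      (d : D ⟶ S.obj ⊗ S'.obj), k = d.hom ≫ tensorι hC S S' := by
  have := CSubPair.nonempty hC X₁ X₂
  have := CSubPair.isDirectedOrder hC X₁ X₂
  obtain ⟨⟨S, S'⟩, d, hd⟩ := hC.exists_factor (directedTensorIsColimit hC X₁ X₂)
    (fun W => (W.fst.obj ⊗ W.snd.obj).property) D.property k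
  exact ⟨S, S', ObjectProperty.homMk d, hd.symm⟩

theorem exists_transition_of_comp_tensorι {X₁ X₂ : WeakModule V} {D : C.FullSubcategory}
    {S : CSub C X₁} {S' : CSub C X₂} (d d' : D ⟶ S.obj ⊗ S'.obj)
    (h : d.hom ≫ tensorι hC S S' = d'.hom ≫ tensorι hC S S') :
    ∃ (R : CSub C X₁) (R' : CSub C X₂) (i : S ≤ R) (i' : S' ≤ R'),
      d ≫ (CSub.transition i ⊗ₘ CSub.transition i') =
        d' ≫ (CSub.transition i ⊗ₘ CSub.transition i') := by
  have := CSubPair.nonempty hC X₁ X₂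
  have := CSubPair.isDirectedOrder hC X₁ X₂
  obtain ⟨R, i, hi⟩ := hC.exists_comp_map_eq (directedTensorIsColimit hC X₁ X₂) D.property
    (j := ⟨S, S'⟩) d.hom d'.hom h
  exact ⟨R.fst, R.snd, (leOfHom i).1, (leOfHom i).2, ObjectProperty.hom_ext _ hi⟩

/-- Directedness brings both legs to one pair of submodules; compactness of `D` then gives a larger
pair on which the two maps agree. -/
theorem tensorLeg_exists_refine {X₁ X₂ : WeakModule V} {D A B A' B' : C.FullSubcategory}
    (f : A.obj ⟶ X₁) (g : B.obj ⟶ X₂) (f' : A'.obj ⟶ X₁) (g' : B'.obj ⟶ X₂) (d : D ⟶ A ⊗ B)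
    (d' : D ⟶ A' ⊗ B') (h : d.hom ≫ tensorLeg hC f g = d'.hom ≫ tensorLeg hC f' g') :
    ∃ (S : CSub C X₁) (S' : CSub C X₂) (a : A ⟶ S.obj) (b : B ⟶ S'.obj) (a' : A' ⟶ S.obj)
      (b' : B' ⟶ S'.obj), a.hom ≫ S.incl = f ∧ b.hom ≫ S'.incl = g ∧ a'.hom ≫ S.incl = f' ∧
      b'.hom ≫ S'.incl = g' ∧ d ≫ (a ⊗ₘ b) = d' ≫ (a' ⊗ₘ b') := by
  obtain ⟨S, a, a', rfl, rfl⟩ := CSub.exists_ge_image hC f f'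
  obtain ⟨S', b, b', rfl, rfl⟩ := CSub.exists_ge_image hC g g'
  rw [← tensorLeg_eq, ← tensorLeg_eq, ← Category.assoc, ← Category.assoc] at h
  obtain ⟨R, R', i, i', e⟩ := exists_transition_of_comp_tensorι hC (d ≫ (a ⊗ₘ b))
    (d' ≫ (a' ⊗ₘ b')) h
  simp only [Category.assoc, tensorHom_comp_tensorHom] at e
  exact ⟨R, R', _, _, _, _, rfl, rfl, rfl, rfl, e⟩

/-- The tensor product on `Ind(C)` extending the one on `C`. -/
def indTensorExtension (hV : C V.adjoint) (e : 𝟙_ C.FullSubcategory ≅ ⟨V.adjoint, hV⟩) :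
    TensorExtension (toInd hC) where
  obj X Y := ⟨(tensorCocone hC X.obj Y.obj).pt, indCompletion_tensorCocone hC _ _⟩
  leg f g := ObjectProperty.homMk (tensorLeg hC f.hom g.hom)
  map_leg a b f g := ObjectProperty.hom_ext _ (comp_tensorLeg hC a b f.hom g.hom)
  exists_desc {X Y Z} ψ hψ := by
    -- Only the values of `ψ` at inclusions define the map; values at general `f` and `g` are
    -- recovered through their images.
    let s : Cocone (tensorSystem C X.obj Y.obj) :=
      { pt := Z.obj
        ι :=
          { app := fun W => (ψ (W.1.inclInd hC) (W.2.inclInd hC)).hom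
            naturality := fun W W' h => by
              refine Eq.trans ?_ (Category.comp_id _).symm
              exact congrArg InducedCategory.Hom.hom
                (hψ (CSub.transition (leOfHom h.1)) (CSub.transition (leOfHom h.2))
                  (W'.1.inclInd hC) (W'.2.inclInd hC)) } }
    refine ⟨ObjectProperty.homMk ((tensorIsColimit hC _ _).desc s), fun {A B} f g =>
      ObjectProperty.hom_ext _ ?_⟩
    refine (Category.assoc _ _ _).trans ?_
    refine (congrArg ((CSub.toImage hC (W := A) f.hom ⊗ₘ CSub.toImage hC (W := B) g.hom).hom ≫ ·)
      ((tensorIsColimit hC _ _).fac s (_, _))).trans ?_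
    exact congrArg InducedCategory.Hom.hom
      (hψ (CSub.toImage hC (W := A) f.hom) (CSub.toImage hC (W := B) g.hom)
        (CSub.inclInd hC _) (CSub.inclInd hC _))
  hom_ext {X Y Z} u v h := ObjectProperty.hom_ext _ <|
    (tensorIsColimit hC _ _).hom_ext fun W => by
      change tensorι hC W.1 W.2 ≫ u.hom = tensorι hC W.1 W.2 ≫ v.hom
      rw [← tensorLeg_incl]
      exact congrArg InducedCategory.Hom.hom (h (W.1.inclInd hC) (W.2.inclInd hC))
  exists_factor {X Y D} k := by
    obtain ⟨S, S', d, h⟩ := tensorLeg_exists_factor hC (D := D) k.hom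
    refine ⟨S.obj, S'.obj, S.inclInd hC, S'.inclInd hC, d, ObjectProperty.hom_ext _ ?_⟩
    rw [← tensorLeg_incl] at h
    exact h
  exists_refine {X Y D A B A' B'} f g f' g' d d' h := by
    obtain ⟨S, S', a, b, a', b', h₁, h₂, h₃, h₄, h₅⟩ :=
      tensorLeg_exists_refine hC (A := A) (A' := A') (B := B) (B' := B') f.hom g.hom f'.hom g'.hom
        d d' (congrArg InducedCategory.Hom.hom h)
    exact ⟨S.obj, S'.obj, S.inclInd hC, S'.inclInd hC, a, b, a', b', ObjectProperty.hom_ext _ h₁,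
      ObjectProperty.hom_ext _ h₂, ObjectProperty.hom_ext _ h₃, ObjectProperty.hom_ext _ h₄, h₅⟩
  exists_desc_obj {X Z} ψ hψ := by
    obtain ⟨hc⟩ := CSub.nonempty_isColimit_systemCocone hC ((indCompletion_iff hC _).1 X.property)
    let s : Cocone (CSub.system C X.obj ⋙ C.ι) :=
      { pt := Z.obj
        ι :=
          { app := fun W => (ψ (CSub.inclInd hC W)).hom
            naturality := fun W W' h => by
              refine Eq.trans ?_ (Category.comp_id _).symm
              exact congrArg InducedCategory.Hom.hom
                (hψ (CSub.transition (leOfHom h)) (CSub.inclInd hC W')) } }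
    refine ⟨ObjectProperty.homMk (hc.desc s), fun {A} f => ObjectProperty.hom_ext _ ?_⟩
    have h := hc.fac s (CSub.image hC (W := A) f.hom)
    refine Eq.trans (congrArg ((CSub.toImage hC (W := A) f.hom).hom ≫ ·) h) ?_
    exact congrArg InducedCategory.Hom.hom
      (hψ (CSub.toImage hC (W := A) f.hom) (CSub.inclInd hC _))
  hom_ext_obj {X Z} u v h := by
    obtain ⟨hc⟩ := CSub.nonempty_isColimit_systemCocone hC ((indCompletion_iff hC _).1 X.property)
    exact ObjectProperty.hom_ext _ <| hc.hom_ext fun W =>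
      congrArg InducedCategory.Hom.hom (h (CSub.inclInd hC W))
  unit := ⟨V.adjoint, hC.le_indCompletion _ hV⟩
  unitIso := (toInd hC).mapIso e

end IndTensor

section InducedStructure

open WeakModule

variable {V : VertexOperatorAlgebra.{u}} {C : ObjectProperty (WeakModule V)}

/-- Both maps land in a common `C`-submodule of `X`. This is the hypothesis under which the extended
tensor product is additive. -/
theorem CSub.exists_common_factor (hC : IsAdmissible C) {X : (IndCompletion C).FullSubcategory}
    {A : C.FullSubcategory} (f g : (toInd hC).obj A ⟶ X) :
    ∃ (B : C.FullSubcategory) (k : (toInd hC).obj B ⟶ X) (a b : A ⟶ B),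
      f = (toInd hC).map a ≫ k ∧ g = (toInd hC).map b ≫ k := by
  obtain ⟨S, a, b, h, h'⟩ := CSub.exists_ge_image hC (A := A) (A' := A) f.hom g.hom
  exact ⟨S.obj, S.inclInd hC, a, b, ObjectProperty.hom_ext _ h.symm,
    ObjectProperty.hom_ext _ h'.symm⟩

variable {hC : IsAdmissible C} [MonoidalCategory C.FullSubcategory]
  (T : TensorExtension (toInd hC))

namespace TensorExtension

/-! #### The Fubini isomorphisms -/

/-- A cocone gives values only on triples of submodules. It is extended to arbitrary maps through
their images and fed to `exists_desc_left`; uniqueness is `hom_ext_left`, and `isDirectLimit_of_ind`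
allows arbitrary targets. -/
theorem isDirectLimit_left (X₁ X₂ X₃ : (IndCompletion C).FullSubcategory) :
    IsDirectLimit (tensorSystemLeft C X₁.obj X₂.obj X₃.obj) (T.obj (T.obj X₁ X₂) X₃).obj
      (fun W => (T.leg (T.leg (W.1.inclInd hC) (W.2.1.inclInd hC)) (W.2.2.inclInd hC)).hom) := by
  have hleg : ∀ {A B E : C.FullSubcategory} (f : (toInd hC).obj A ⟶ X₁)
      (g : (toInd hC).obj B ⟶ X₂) (k : (toInd hC).obj E ⟶ X₃),
      T.leg (T.leg f g) k = (toInd hC).map ((CSub.toImage hC (W := A) f.hom ⊗ₘ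
        CSub.toImage hC (W := B) g.hom) ⊗ₘ CSub.toImage hC (W := E) k.hom) ≫
        T.leg (T.leg (CSub.inclInd hC _) (CSub.inclInd hC _)) (CSub.inclInd hC _) := by
    intro A B E f g k
    rw [T.map_leg, T.map_leg]
    rfl
  refine isDirectLimit_of_ind hC (fun W => ((W.1.obj ⊗ W.2.1.obj) ⊗ W.2.2.obj).property)
    (T.obj (T.obj X₁ X₂) X₃).property _ (fun {W W'} h => ?_) (fun Z hZ ψ hψ => ?_)
    fun Z hZ u v h => ?_
  · have : (toInd hC).map ((CSub.transition (leOfHom h.1) ⊗ₘ CSub.transition (leOfHom h.2.1)) ⊗ₘ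
          CSub.transition (leOfHom h.2.2)) ≫
        T.leg (T.leg (W'.1.inclInd hC) (W'.2.1.inclInd hC)) (W'.2.2.inclInd hC) =
        T.leg (T.leg (W.1.inclInd hC) (W.2.1.inclInd hC)) (W.2.2.inclInd hC) := by
      rw [T.map_leg, T.map_leg]
      rfl
    exact congrArg InducedCategory.Hom.hom this
  · let ψ' : ∀ (S₁ : CSub C X₁.obj) (S₂ : CSub C X₂.obj) (S₃ : CSub C X₃.obj),
        ((toInd hC).obj ((S₁.obj ⊗ S₂.obj) ⊗ S₃.obj) ⟶
          (⟨Z, hZ⟩ : (IndCompletion C).FullSubcategory)) :=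
      fun S₁ S₂ S₃ => ObjectProperty.homMk (ψ (S₁, S₂, S₃))
    let Ψ : ∀ {A B E : C.FullSubcategory}, ((toInd hC).obj A ⟶ X₁) → ((toInd hC).obj B ⟶ X₂) →
        ((toInd hC).obj E ⟶ X₃) →
        ((toInd hC).obj ((A ⊗ B) ⊗ E) ⟶ (⟨Z, hZ⟩ : (IndCompletion C).FullSubcategory)) :=
      fun {A B E} f g k => (toInd hC).map ((CSub.toImage hC (W := A) f.hom ⊗ₘ
        CSub.toImage hC (W := B) g.hom) ⊗ₘ CSub.toImage hC (W := E) k.hom) ≫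
        ψ' (CSub.image hC (W := A) f.hom) (CSub.image hC (W := B) g.hom)
          (CSub.image hC (W := E) k.hom)
    -- The extended family may be computed through any containing submodules; this yields its
    -- naturality and its agreement with `ψ` on inclusions.
    have key : ∀ {A B E : C.FullSubcategory} (S₁ : CSub C X₁.obj) (S₂ : CSub C X₂.obj)
        (S₃ : CSub C X₃.obj) (a : A ⟶ S₁.obj) (b : B ⟶ S₂.obj) (e : E ⟶ S₃.obj),
        (toInd hC).map ((a ⊗ₘ b) ⊗ₘ e) ≫ ψ' S₁ S₂ S₃ =
        Ψ ((toInd hC).map a ≫ S₁.inclInd hC) ((toInd hC).map b ≫ S₂.inclInd hC)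
          ((toInd hC).map e ≫ S₃.inclInd hC) := by
      intro A B E S₁ S₂ S₃ a b e
      obtain ⟨h₁, e₁⟩ := CSub.exists_eq_toImage_comp_transition hC S₁ a
      obtain ⟨h₂, e₂⟩ := CSub.exists_eq_toImage_comp_transition hC S₂ b
      obtain ⟨h₃, e₃⟩ := CSub.exists_eq_toImage_comp_transition hC S₃ e
      have h := hψ (i := (_, _, _)) (j := (S₁, S₂, S₃)) (homOfLE h₁, homOfLE h₂, homOfLE h₃)
      have h' : (toInd hC).map ((CSub.transition h₁ ⊗ₘ CSub.transition h₂) ⊗ₘ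
          CSub.transition h₃) ≫ ψ' S₁ S₂ S₃ = ψ' _ _ _ :=
        ObjectProperty.hom_ext _ h
      conv_lhs => rw [← e₁, ← e₂, ← e₃]
      rw [← tensorHom_comp_tensorHom, ← tensorHom_comp_tensorHom, Functor.map_comp, Category.assoc,
        h']
      rfl
    obtain ⟨u, hu⟩ := T.exists_desc_left Ψ fun {A B E A' B' E'} a b e f g k => by
      rw [← Functor.map_comp_assoc, tensorHom_comp_tensorHom, tensorHom_comp_tensorHom, key]
      rfl
    refine ⟨u.hom, fun W => congrArg InducedCategory.Hom.hom ((hu _ _ _).trans ?_)⟩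
    have := key W.1 W.2.1 W.2.2 (𝟙 _) (𝟙 _) (𝟙 _)
    rw [id_tensorHom_id, id_tensorHom_id] at this
    exact this.symm
  · have := T.hom_ext_left (Z := ⟨Z, hZ⟩) (u := ObjectProperty.homMk u)
      (v := ObjectProperty.homMk v) fun f g k => by
        rw [hleg f g k, Category.assoc, Category.assoc]
        congr 1
        exact ObjectProperty.hom_ext _ (h (_, _, _))
    exact congrArg InducedCategory.Hom.hom this

theorem isDirectLimit_right (X₁ X₂ X₃ : (IndCompletion C).FullSubcategory) :
    IsDirectLimit (tensorSystemRight C X₁.obj X₂.obj X₃.obj) (T.obj X₁ (T.obj X₂ X₃)).obj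
      (fun W => (T.leg (W.1.inclInd hC) (T.leg (W.2.1.inclInd hC) (W.2.2.inclInd hC))).hom) := by
  have hleg : ∀ {A B E : C.FullSubcategory} (f : (toInd hC).obj A ⟶ X₁)
      (g : (toInd hC).obj B ⟶ X₂) (k : (toInd hC).obj E ⟶ X₃),
      T.leg f (T.leg g k) = (toInd hC).map (CSub.toImage hC (W := A) f.hom ⊗ₘ
        (CSub.toImage hC (W := B) g.hom ⊗ₘ CSub.toImage hC (W := E) k.hom)) ≫
        T.leg (CSub.inclInd hC _) (T.leg (CSub.inclInd hC _) (CSub.inclInd hC _)) := by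
    intro A B E f g k
    rw [T.map_leg, T.map_leg]
    rfl
  refine isDirectLimit_of_ind hC (fun W => (W.1.obj ⊗ (W.2.1.obj ⊗ W.2.2.obj)).property)
    (T.obj X₁ (T.obj X₂ X₃)).property _ (fun {W W'} h => ?_) (fun Z hZ ψ hψ => ?_)
    fun Z hZ u v h => ?_
  · have : (toInd hC).map (CSub.transition (leOfHom h.1) ⊗ₘ (CSub.transition (leOfHom h.2.1) ⊗ₘ
          CSub.transition (leOfHom h.2.2))) ≫
        T.leg (W'.1.inclInd hC) (T.leg (W'.2.1.inclInd hC) (W'.2.2.inclInd hC)) =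
        T.leg (W.1.inclInd hC) (T.leg (W.2.1.inclInd hC) (W.2.2.inclInd hC)) := by
      rw [T.map_leg, T.map_leg]
      rfl
    exact congrArg InducedCategory.Hom.hom this
  · let ψ' : ∀ (S₁ : CSub C X₁.obj) (S₂ : CSub C X₂.obj) (S₃ : CSub C X₃.obj),
        ((toInd hC).obj (S₁.obj ⊗ (S₂.obj ⊗ S₃.obj)) ⟶
          (⟨Z, hZ⟩ : (IndCompletion C).FullSubcategory)) :=
      fun S₁ S₂ S₃ => ObjectProperty.homMk (ψ (S₁, S₂, S₃))
    let Ψ : ∀ {A B E : C.FullSubcategory}, ((toInd hC).obj A ⟶ X₁) → ((toInd hC).obj B ⟶ X₂) →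
        ((toInd hC).obj E ⟶ X₃) →
        ((toInd hC).obj (A ⊗ (B ⊗ E)) ⟶ (⟨Z, hZ⟩ : (IndCompletion C).FullSubcategory)) :=
      fun {A B E} f g k => (toInd hC).map (CSub.toImage hC (W := A) f.hom ⊗ₘ
        (CSub.toImage hC (W := B) g.hom ⊗ₘ CSub.toImage hC (W := E) k.hom)) ≫
        ψ' (CSub.image hC (W := A) f.hom) (CSub.image hC (W := B) g.hom)
          (CSub.image hC (W := E) k.hom)
    have key : ∀ {A B E : C.FullSubcategory} (S₁ : CSub C X₁.obj) (S₂ : CSub C X₂.obj)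
        (S₃ : CSub C X₃.obj) (a : A ⟶ S₁.obj) (b : B ⟶ S₂.obj) (e : E ⟶ S₃.obj),
        (toInd hC).map (a ⊗ₘ (b ⊗ₘ e)) ≫ ψ' S₁ S₂ S₃ =
        Ψ ((toInd hC).map a ≫ S₁.inclInd hC) ((toInd hC).map b ≫ S₂.inclInd hC)
          ((toInd hC).map e ≫ S₃.inclInd hC) := by
      intro A B E S₁ S₂ S₃ a b e
      obtain ⟨h₁, e₁⟩ := CSub.exists_eq_toImage_comp_transition hC S₁ a
      obtain ⟨h₂, e₂⟩ := CSub.exists_eq_toImage_comp_transition hC S₂ b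
      obtain ⟨h₃, e₃⟩ := CSub.exists_eq_toImage_comp_transition hC S₃ e
      have h := hψ (i := (_, _, _)) (j := (S₁, S₂, S₃)) (homOfLE h₁, homOfLE h₂, homOfLE h₃)
      have h' : (toInd hC).map (CSub.transition h₁ ⊗ₘ (CSub.transition h₂ ⊗ₘ
          CSub.transition h₃)) ≫ ψ' S₁ S₂ S₃ = ψ' _ _ _ :=
        ObjectProperty.hom_ext _ h
      conv_lhs => rw [← e₁, ← e₂, ← e₃]
      rw [← tensorHom_comp_tensorHom, ← tensorHom_comp_tensorHom, Functor.map_comp, Category.assoc,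
        h']
      rfl
    obtain ⟨u, hu⟩ := T.exists_desc_right Ψ fun {A B E A' B' E'} a b e f g k => by
      rw [← Functor.map_comp_assoc, tensorHom_comp_tensorHom, tensorHom_comp_tensorHom, key]
      rfl
    refine ⟨u.hom, fun W => congrArg InducedCategory.Hom.hom ((hu _ _ _).trans ?_)⟩
    have := key W.1 W.2.1 W.2.2 (𝟙 _) (𝟙 _) (𝟙 _)
    rw [id_tensorHom_id, id_tensorHom_id] at this
    exact this.symm
  · have := T.hom_ext_right (Z := ⟨Z, hZ⟩) (u := ObjectProperty.homMk u)
      (v := ObjectProperty.homMk v) fun f g k => by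
        rw [hleg f g k, Category.assoc, Category.assoc]
        congr 1
        exact ObjectProperty.hom_ext _ (h (_, _, _))
    exact congrArg InducedCategory.Hom.hom this

end TensorExtension

/-! #### The induced structure -/

section Main

variable (hC) (hV : C V.adjoint) (e : 𝟙_ C.FullSubcategory ≅ ⟨V.adjoint, hV⟩)

/-- The homomorphisms `φ_{W₁, W₂} : W₁ ⊠ W₂ ⟶ X₁ ⊠̂ X₂`. -/
def inducedLegs :
    @TensorLegs V C _ (indTensorExtension hC hV e).monoidalCategory :=
  fun _ _ W₁ W₂ => ((indTensorExtension hC hV e).leg (W₁.inclInd hC) (W₂.inclInd hC)).hom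

/-- Passing through the image of `f` does not change the leg. With `f` itself a leg, this identifies
`iteratedLeft` with a nested leg. -/
theorem leg_incl_toImage_left {X Y : (IndCompletion C).FullSubcategory} {A B : C.FullSubcategory}
    (f : (toInd hC).obj A ⟶ X) (g : (toInd hC).obj B ⟶ Y) :
    (toInd hC).map (CSub.toImage hC (W := A) f.hom ▷ B) ≫ T.leg (CSub.inclInd hC _) g =
      T.leg f g := by
  rw [← T.leg_map_left]
  rfl

theorem leg_incl_toImage_right {X Y : (IndCompletion C).FullSubcategory} {A B : C.FullSubcategory}
    (f : (toInd hC).obj A ⟶ X) (g : (toInd hC).obj B ⟶ Y) :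
    (toInd hC).map (A ◁ CSub.toImage hC (W := B) g.hom) ≫ T.leg f (CSub.inclInd hC _) =
      T.leg f g := by
  rw [← T.leg_map_right]
  rfl

/-- Matches the abstract preimage in the unitor formula with the explicit map `U ⟶ V` followed by
`e.inv`. -/
theorem preimage_inclInd_comp (U : CSub C (indTensorExtension hC hV e).unit.obj) :
    (toInd hC).preimage (CSub.inclInd hC U ≫
      (indTensorExtension hC hV e).unitIso.inv) =
      (ObjectProperty.homMk U.incl : U.obj ⟶ ⟨V.adjoint, hV⟩) ≫ e.inv :=
  (toInd hC).map_injective (by rw [Functor.map_preimage]; rfl)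

theorem isInducedStructure [BraidedCategory C.FullSubcategory]
    (θ : 𝟭 C.FullSubcategory ≅ 𝟭 C.FullSubcategory) :
    let _ := (indTensorExtension hC hV e).monoidalCategory
    let _ := (indTensorExtension hC hV e).braidedCategory
    IsInducedStructure hC hV e θ ((indTensorExtension hC hV e).twist θ)
      (inducedLegs hC hV e) := by
  let _ := (indTensorExtension hC hV e).monoidalCategory
  let _ := (indTensorExtension hC hV e).braidedCategory
  have hright : ∀ (X₁ X₂ X₃ : (IndCompletion C).FullSubcategory)
      (W₁ : CSub C X₁.obj) (W₂ : CSub C X₂.obj) (W₃ : CSub C X₃.obj),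
      iteratedRight hC (inducedLegs hC hV e) X₁ X₂ X₃ W₁ W₂ W₃ =
        ((indTensorExtension hC hV e).leg (W₁.inclInd hC)
          ((indTensorExtension hC hV e).leg (W₂.inclInd hC) (W₃.inclInd hC))).hom :=
    fun X₁ X₂ X₃ W₁ W₂ W₃ => congrArg InducedCategory.Hom.hom
      (leg_incl_toImage_right hC (indTensorExtension hC hV e) _ _)
  have hleft : ∀ (X₁ X₂ X₃ : (IndCompletion C).FullSubcategory)
      (W₁ : CSub C X₁.obj) (W₂ : CSub C X₂.obj) (W₃ : CSub C X₃.obj),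
      iteratedLeft hC (inducedLegs hC hV e) X₁ X₂ X₃ W₁ W₂ W₃ =
        ((indTensorExtension hC hV e).leg ((indTensorExtension hC hV e).leg (W₁.inclInd hC)
          (W₂.inclInd hC)) (W₃.inclInd hC)).hom :=
    fun X₁ X₂ X₃ W₁ W₂ W₃ => congrArg InducedCategory.Hom.hom
      (leg_incl_toImage_left hC (indTensorExtension hC hV e) _ _)
  refine
    { tensor_obj := fun X₁ X₂ => ⟨(tensorCocone hC X₁.obj X₂.obj).ι,
        fun W => (tensorLeg_incl hC W.1 W.2).symm, ⟨tensorIsColimit hC X₁.obj X₂.obj⟩⟩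
      tensor_hom := fun F₁ F₂ W₁ W₂ => ?_
      unit_obj := rfl
      left_unit := fun X U W => ?_
      right_unit := fun X W U => ?_
      fubini_right := fun X₁ X₂ X₃ => ?_
      fubini_left := fun X₁ X₂ X₃ => ?_
      associativity := fun X₁ X₂ X₃ W₁ W₂ W₃ => ?_
      braiding := fun X₁ X₂ W₁ W₂ => congrArg InducedCategory.Hom.hom
        ((indTensorExtension hC hV e).leg_braid_hom (W₁.inclInd hC) (W₂.inclInd hC))
      twist := fun X W => congrArg InducedCategory.Hom.hom
        ((indTensorExtension hC hV e).comp_twist θ (W.inclInd hC)) }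
  · refine congrArg InducedCategory.Hom.hom
      (((indTensorExtension hC hV e).leg_map F₁ F₂ (W₁.inclInd hC) (W₂.inclInd hC)).trans ?_)
    exact ((indTensorExtension hC hV e).map_leg (CSub.restrict hC F₁.hom W₁)
      (CSub.restrict hC F₂.hom W₂) (CSub.inclInd hC _) (CSub.inclInd hC _)).symm
  · have h := (indTensorExtension hC hV e).leg_leftUnitorHom (CSub.inclInd hC U) (W.inclInd hC)
    rw [preimage_inclInd_comp] at h
    exact congrArg InducedCategory.Hom.hom h
  · have h := (indTensorExtension hC hV e).leg_rightUnitorHom (W.inclInd hC) (CSub.inclInd hC U)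
    rw [preimage_inclInd_comp] at h
    exact congrArg InducedCategory.Hom.hom h
  · simp only [hright]
    exact (indTensorExtension hC hV e).isDirectLimit_right X₁ X₂ X₃
  · simp only [hleft]
    exact (indTensorExtension hC hV e).isDirectLimit_left X₁ X₂ X₃
  · rw [hright, hleft]
    exact congrArg InducedCategory.Hom.hom ((indTensorExtension hC hV e).leg_assoc_inv
      (W₁.inclInd hC) (W₂.inclInd hC) (W₃.inclInd hC))

end Main

end InducedStructure

end

theorem mainTheorem3 (V : VertexOperatorAlgebra.{u}) (C : ObjectProperty (WeakModule V))
    (hC : IsAdmissible C) (hV : C V.adjoint)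
    [MonoidalCategory C.FullSubcategory] [BraidedCategory C.FullSubcategory]
    [MonoidalPreadditive C.FullSubcategory] [MonoidalLinear ℂ C.FullSubcategory]
    (e : 𝟙_ C.FullSubcategory ≅ ⟨V.adjoint, hV⟩)
    (θ : 𝟭 C.FullSubcategory ≅ 𝟭 C.FullSubcategory) (hθ : IsTwist θ)
    (hleft : ∀ W : C.FullSubcategory, PreservesFiniteColimits (tensorLeft W))
    (hright : ∀ W : C.FullSubcategory, PreservesFiniteColimits (tensorRight W)) :
    (∃ A : Abelian (IndCompletion C).FullSubcategory,
      A.toPreadditive = Preadditive.fullSubcategory (IndCompletion C)) ∧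
    ∃ (_ : MonoidalCategory (IndCompletion C).FullSubcategory)
      (_ : BraidedCategory (IndCompletion C).FullSubcategory)
      (_ : MonoidalPreadditive (IndCompletion C).FullSubcategory)
      (_ : MonoidalLinear ℂ (IndCompletion C).FullSubcategory)
      (Θ : 𝟭 (IndCompletion C).FullSubcategory ≅ 𝟭 (IndCompletion C).FullSubcategory)
      (φ : TensorLegs C),
      IsTwist Θ ∧ IsInducedStructure hC hV e θ Θ φ := by
  let T := indTensorExtension hC hV e
  let := T.monoidalCategory
  let := T.braidedCategory
  let := T.monoidalPreadditive (CSub.exists_common_factor hC)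
  exact ⟨abelian_indCompletion hC, T.monoidalCategory, T.braidedCategory,
    T.monoidalPreadditive (CSub.exists_common_factor hC), T.monoidalLinear ℂ _, T.twist θ,
    inducedLegs hC hV e, ⟨T.twist_unit θ hθ.unit, T.twist_balancing θ hθ.balancing⟩,
    isInducedStructure hC hV e θ⟩
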